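/- **Setting.** Let $\iota$ be a finite set of features, let feature $k$ take values in a measurable space $\mathcal X_k$, and put $\mathcal X=\prod_k\mathcal X_k$. Let $X^1,X^2,\dots$ be i.i.d. $\mathcal X$-valued feature vectors with law $Q$, and let the labels be $y^n=p(X^n)$ for a deterministic labeling function $p:\mathcal X\to\mathbb R$. A feature $k$ is *determining* if $p(x)\ne p(x')$ for some $x,x'\in\mathcal X$ that differ only in coordinate $k$; write $S(p)$ for the set of determining features. **Model.** Fix a one-parameter natural exponential family with densities $e^{\vartheta y-A(\vartheta)}$, $A(\vartheta)=\log\int e^{\vartheta y}\,d\nu(y)$, with respect to a $\sigma$-finite measure $\nu$ on $\mathbb R$ not concentrated at one point, where $\vartheta$ ranges over the interior of the natural parameter space (a known dispersion, such as the variance of an additive Gaussian model, is absorbed in $\nu$). Let $\mathcal M$ be the set of its means and let $g$ be a continuous injective link function on $\mathcal M$. A GAM has $$g(\mathbb E_\theta[Y\mid x])=\eta_\theta(x)=\alpha+\sum_k f_k(x_k)+\sum_{i\ne j}f_{ij}(x_i,x_j),$$ where every feature shape $f_k$ or $f_{ij}$ is a linear combination of finitely many given measurable basis functions (for example regression splines;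 a pair may have none), and $\theta$ consists of the intercept $\alpha$ and all coefficients. The parameter set is $\Theta=\{\theta:\eta_\theta(x)\in g(\mathcal M)\text{ for all }x\in\mathcal X\}$. Write $\mu_\theta(x)=\mathbb E_\theta[Y\mid x]$. Interactions are assumed hierarchical: freezing one argument of a pairwise basis function gives a constant plus a linear combination of the basis functions of the other feature (true for tensor products of the univariate bases, vacuous without interactions). The model is assumed identifiable: the map from $\theta\in\Theta$ to the joint law of $(x,Y)$, with $x\sim Q$ and $Y\mid x$ distributed according to the model, is injective. An MLE $\theta_N$ is any maximizer over $\Theta$ of the likelihood $\prod_{n\le N}p_\theta(y^n\mid X^n)$. Let $\theta_0\in\Theta$. **Proposition (Nullification).** 1. (*The labeling function lies in the model.*) If $p(x)=\mu_{\theta_0}(x)$ for all $x\in\mathcal X$, then with probability tending to $1$ as $N\to\infty$ an MLE exists, and every MLE $\theta_N$ satisfies: $\theta_N=\theta_0$; for every determining feature $k$ some feature shape of $\theta_N$ involving $k$ is not the zero function; the shapes of the determining features alone reproduce the labeling function, that is, for all $x\in\mathcal X$, $g(p(x))=\alpha+\sum_{k\in S(p)}f_k(x_k)+\sum_{i\ne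 j;\,i,j\in S(p)}f_{ij}(x_i,x_j)$ with the intercept and shapes of $\theta_N$; and for every feature $j\notin S(p)$ all feature shapes involving $j$ are constant zero functions. 2. (*The labeling function is approximated by the model.*) Suppose that all basis functions are bounded and that $\mu_{\theta_0}$ takes its values in a compact subset of $\mathcal M$. Then for every $\varepsilon>0$ there is $\delta>0$ such that, for every $p:\mathcal X\to\mathbb R$ with $\sup_x|p(x)-\mu_{\theta_0}(x)|\le\delta$, with probability tending to $1$ as $N\to\infty$ an MLE exists, and every MLE $\theta_N$ satisfies: $|\theta_N-\theta_0|\le\varepsilon$; for every feature $k$ such that $|p(x)-p(x')|\ge\varepsilon$ for some $x,x'$ differing only in coordinate $k$, some feature shape involving $k$ is not the zero function; for all $x\in\mathcal X$, $|\mu_{\theta_N}(x)-p(x)|\le\varepsilon$ and $\big|g(p(x))-\alpha-\sum_{k\in S(p)}f_k(x_k)-\sum_{i\ne j;\,i,j\in S(p)}f_{ij}(x_i,x_j)\big|\le\varepsilon$ with the intercept and shapes of $\theta_N$; and for every feature $j\notin S(p)$ all feature shapes involving $j$ are bounded by $\varepsilon$ in absolute value. Here $|\cdot|$ on parameters is the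 maximum norm, and "with probability tending to $1$" means that the outer probability of the complement tends to $0$. -/

import Mathlib

open MeasureTheory ProbabilityTheory Filter Topology

noncomputable section

/-! ### One-parameter natural exponential families

The family with base measure `ν` on `ℝ` has the members `exp (ϑ y - A ϑ) ν(dy)`, where
`A ϑ = log ∫ exp (ϑ y) ν(dy) = cgf id ν ϑ`. A known dispersion parameter is absorbed into `ν`. -/

/-- The interior of the natural parameter space. -/
def natSpace (ν : Measure ℝ) : Set ℝ := interior (integrableExpSet id ν)

/-- The density, with respect to the base measure `ν`, of the member with natural parameter `ϑ`. -/
def famDensity (ν : Measure ℝ) (ϑ y : ℝ) : ℝ := Real.exp (ϑ * y - cgf id ν ϑ)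

/-- The mean of the member with natural parameter `ϑ`. -/
def famMean (ν : Measure ℝ) (ϑ : ℝ) : ℝ := ∫ y, y * famDensity ν ϑ y ∂ν

/-- The mean space of the family. -/
def meanSpace (ν : Measure ℝ) : Set ℝ := famMean ν '' natSpace ν

/-- The natural parameter that belongs to the value `t` of the linear predictor under the link
function `g`, that is, the solution `ϑ` of `g (mean ϑ) = t`. -/
def natParam (ν : Measure ℝ) (g : ℝ → ℝ) (t : ℝ) : ℝ :=
  Function.invFunOn (fun ϑ => g (famMean ν ϑ)) (natSpace ν) t

/-! ### Generalized additive models -/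

/-- The ordered pairs `(i, j)` of distinct features. -/
abbrev FeaturePair (ι : Type*) : Type _ := {q : ι × ι // q.1 ≠ q.2}

/-- The design of a generalized additive model whose features `k : ι` take values in `𝓧 k`:
a response family with base measure `base`, a link function, and for every feature and every
pair of features a finite family of basis functions (for instance splines) in which the feature
shape is expanded. A pair with `pairDim q = 0` has no interaction term. -/
structure GAM (ι : Type*) (𝓧 : ι → Type*) [∀ k, MeasurableSpace (𝓧 k)] where
  base : Measure ℝ
  sigmaFinite_base : SigmaFinite base
  /-- The response family does not consist of point masses. -/
  base_nondegenerate : ∀ c : ℝ, base {c}ᶜ ≠ 0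
  link : ℝ → ℝ
  link_continuousOn : ContinuousOn link (meanSpace base)
  link_injOn : Set.InjOn link (meanSpace base)
  dim : ι → ℕ
  basis : (k : ι) → Fin (dim k) → 𝓧 k → ℝ
  measurable_basis : ∀ k m, Measurable (basis k m)
  pairDim : FeaturePair ι → ℕ
  pairBasis : (q : FeaturePair ι) → Fin (pairDim q) → 𝓧 q.1.1 → 𝓧 q.1.2 → ℝ
  measurable_pairBasis : ∀ q m, Measurable (Function.uncurry (pairBasis q m))

namespace GAM

variable {ι : Type*} [Fintype ι] [DecidableEq ι] {𝓧 : ι → Type*} [∀ k, MeasurableSpace (𝓧 k)]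

/-- A parameter: an intercept, the coefficients of the feature shapes, and the coefficients of
the pairwise feature shapes. -/
abbrev Param (M : GAM ι 𝓧) : Type _ :=
  ℝ × ((k : ι) → Fin (M.dim k) → ℝ) × ((q : FeaturePair ι) → Fin (M.pairDim q) → ℝ)

/-- The feature shape `f_k`. -/
def shape (M : GAM ι 𝓧) (θ : M.Param) (k : ι) (a : 𝓧 k) : ℝ :=
  ∑ m, θ.2.1 k m * M.basis k m a

/-- The pairwise feature shape `f_ij` of the pair `q = (i, j)`. -/
def pairShape (M : GAM ι 𝓧) (θ : M.Param) (q : FeaturePair ι) (a : 𝓧 q.1.1) (b : 𝓧 q.1.2) : ℝ :=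
  ∑ m, θ.2.2 q m * M.pairBasis q m a b

/-- The additive predictor: intercept plus all feature shapes. -/
def predictor (M : GAM ι 𝓧) (θ : M.Param) (x : ∀ k, 𝓧 k) : ℝ :=
  θ.1 + ∑ k, M.shape θ k (x k) + ∑ q : FeaturePair ι, M.pairShape θ q (x q.1.1) (x q.1.2)

open Classical in
/-- The part of the additive predictor that uses only the features in `S`. -/
def predictorOn (M : GAM ι 𝓧) (S : Set ι) (θ : M.Param) (x : ∀ k, 𝓧 k) : ℝ :=
  θ.1 + ∑ k, (if k ∈ S then M.shape θ k (x k) else 0) +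
    ∑ q : FeaturePair ι,
      (if q.1.1 ∈ S ∧ q.1.2 ∈ S then M.pairShape θ q (x q.1.1) (x q.1.2) else 0)

/-- The parameter set: the predictor has to take its values in the range of the link function
on the mean space. For a link function onto `ℝ` this is the whole coefficient space. -/
def paramSpace (M : GAM ι 𝓧) : Set M.Param :=
  {θ | ∀ x, M.predictor θ x ∈ M.link '' meanSpace M.base}

/-- The density (with respect to the base measure) of the label `y` given the features `x`. -/
def density (M : GAM ι 𝓧) (θ : M.Param) (x : ∀ k, 𝓧 k) (y : ℝ) : ℝ :=
  famDensity M.base (natParam M.base M.link (M.predictor θ x)) y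

/-- The mean `E[Y | x]` in the model with parameter `θ`. For `θ` in the parameter set,
`g (E[Y | x])` is the additive predictor. -/
def condMean (M : GAM ι 𝓧) (θ : M.Param) (x : ∀ k, 𝓧 k) : ℝ :=
  famMean M.base (natParam M.base M.link (M.predictor θ x))

/-- The joint law of features and label under the parameter `θ` when the features have law `Q`. -/
def jointLaw (M : GAM ι 𝓧) (Q : Measure (∀ k, 𝓧 k)) (θ : M.Param) : Measure ((∀ k, 𝓧 k) × ℝ) :=
  (Q.prod M.base).withDensity fun z => ENNReal.ofReal (M.density θ z.1 z.2)

/-- Identifiability: the map from parameters to laws is injective. -/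
def Identifiable (M : GAM ι 𝓧) (Q : Measure (∀ k, 𝓧 k)) : Prop :=
  Set.InjOn (M.jointLaw Q) M.paramSpace

/-- The likelihood of the data `(x 0, y 0), …, (x (N - 1), y (N - 1))`. -/
def likelihood (M : GAM ι 𝓧) (N : ℕ) (x : ℕ → ∀ k, 𝓧 k) (y : ℕ → ℝ) (θ : M.Param) : ℝ :=
  ∏ n ∈ Finset.range N, M.density θ (x n) (y n)

/-- `θ` is a maximum likelihood estimate from the first `N` data points. -/
def IsMLE (M : GAM ι 𝓧) (N : ℕ) (x : ℕ → ∀ k, 𝓧 k) (y : ℕ → ℝ) (θ : M.Param) : Prop :=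
  θ ∈ M.paramSpace ∧ IsMaxOn (M.likelihood N x y) M.paramSpace θ

/-- Interactions are hierarchical: when one argument of a pairwise basis function is frozen, the
result is a constant plus a combination of the basis functions of the other feature. This holds
for tensor products of the univariate bases, and trivially if there are no interactions. -/
def Hierarchical (M : GAM ι 𝓧) : Prop :=
  ∀ (q : FeaturePair ι) (m : Fin (M.pairDim q)),
    (∀ b, ∃ (c : ℝ) (β : Fin (M.dim q.1.1) → ℝ),
      ∀ a, M.pairBasis q m a b = c + ∑ l, β l * M.basis q.1.1 l a) ∧
    (∀ a, ∃ (c : ℝ) (β : Fin (M.dim q.1.2) → ℝ),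
      ∀ b, M.pairBasis q m a b = c + ∑ l, β l * M.basis q.1.2 l b)

/-- All basis functions are bounded (as splines on compact ranges are). -/
def BoundedBasis (M : GAM ι 𝓧) : Prop :=
  ∃ B : ℝ, (∀ k m a, |M.basis k m a| ≤ B) ∧ (∀ q m a b, |M.pairBasis q m a b| ≤ B)

/-- Some feature shape that involves the feature `k` is not the zero function. -/
def NonzeroShape (M : GAM ι 𝓧) (θ : M.Param) (k : ι) : Prop :=
  (∃ a, M.shape θ k a ≠ 0) ∨
    ∃ q : FeaturePair ι, (q.1.1 = k ∨ q.1.2 = k) ∧ ∃ a b, M.pairShape θ q a b ≠ 0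

/-- All feature shapes that involve the feature `j` are bounded by `r` in absolute value. -/
def ShapeLE (M : GAM ι 𝓧) (θ : M.Param) (j : ι) (r : ℝ) : Prop :=
  (∀ a, |M.shape θ j a| ≤ r) ∧
    ∀ q : FeaturePair ι, (q.1.1 = j ∨ q.1.2 = j) → ∀ a b, |M.pairShape θ q a b| ≤ r

/-- All feature shapes that involve the feature `j` are constant zero functions. -/
def Nullified (M : GAM ι 𝓧) (θ : M.Param) (j : ι) : Prop :=
  (∀ a, M.shape θ j a = 0) ∧
    ∀ q : FeaturePair ι, (q.1.1 = j ∨ q.1.2 = j) → ∀ a b, M.pairShape θ q a b = 0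

end GAM

/-- The features that determine the labels: those on which the labeling function depends. -/
def determining {ι : Type*} [DecidableEq ι] {𝓧 : ι → Type*} (p : (∀ k, 𝓧 k) → ℝ) : Set ι :=
  {k | ∃ (x : ∀ k, 𝓧 k) (a : 𝓧 k), p (Function.update x k a) ≠ p x}

end

/-! For a label `y` the log-density is `ϑ y - A ϑ`, with `A` the strictly convex cumulant function.
If `y` is the mean at `θ₀`, the loss of log-likelihood at `θ` against `θ₀` is the Bregman divergence
of `A` between the two natural parameters: nonnegative, and zero only when the predictors agree. So
noiseless labels make `θ₀` an MLE, and every other MLE has the predictor of `θ₀` on the whole sample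
(`IsMLE.predictor_eq`).

That agreement on the sample forces equality is a uniform law of large numbers. The predictor is
linear in the parameter and the parameter set is convex, so differences of parameters span a
subspace by nonnegative scaling alone; by identifiability no nonzero vector of it has an almost
surely vanishing predictor. Compactness of the unit sphere reduces to finitely many applications of
the strong law: with probability tending to one, all directions are visible with a common frequency
and a common size (`exists_frequency_predictor_sub_ge`).

For approximate labels the Bregman term grows linearly away from a compact set of base points
(`exists_bregman_growth`), while the label error costs at most `δ` times the distance of the natural
parameters. For small `δ` the likelihood outside a ball is below its value at `θ₀`, which confines
every MLE to that ball; compactness gives existence.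

Nullification is algebraic. By hierarchy, freezing coordinate `j` in the predictor gives the
predictor of a parameter without coefficients for `j`. If the mean ignores `j`, both predictors
coincide, and identifiability makes the parameters equal (`nullified_of_not_determining`). -/

/-! ### Natural exponential families -/

section Family

variable {ν : Measure ℝ}

theorem isOpen_natSpace (ν : Measure ℝ) : IsOpen (natSpace ν) := isOpen_interior

theorem convex_natSpace (ν : Measure ℝ) : Convex ℝ (natSpace ν) :=
  convex_integrableExpSet.interior

theorem ne_zero_of_nondegenerate (hν : ∀ c : ℝ, ν {c}ᶜ ≠ 0) : ν ≠ 0 := by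
  rintro rfl
  exact hν 0 rfl

theorem famDensity_eq (hν : ν ≠ 0) {ϑ : ℝ} (hϑ : ϑ ∈ natSpace ν) (y : ℝ) :
    famDensity ν ϑ y = Real.exp (ϑ * y) / mgf id ν ϑ := by
  have : NeZero ν := ⟨hν⟩
  have hi : Integrable (fun ω : ℝ => Real.exp (ϑ * id ω)) ν :=
    interior_subset (s := integrableExpSet id ν) hϑ
  rw [famDensity, Real.exp_sub, exp_cgf hi]

theorem integrable_famDensity (hν : ν ≠ 0) {ϑ : ℝ} (hϑ : ϑ ∈ natSpace ν) :
    Integrable (famDensity ν ϑ) ν := by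
  have hi : Integrable (fun ω : ℝ => Real.exp (ϑ * id ω)) ν :=
    interior_subset (s := integrableExpSet id ν) hϑ
  refine (hi.div_const (mgf id ν ϑ)).congr (Eventually.of_forall fun y => ?_)
  simp [famDensity_eq hν hϑ]

theorem integral_famDensity (hν : ν ≠ 0) {ϑ : ℝ} (hϑ : ϑ ∈ natSpace ν) :
    ∫ y, famDensity ν ϑ y ∂ν = 1 := by
  have hi : Integrable (fun ω : ℝ => Real.exp (ϑ * id ω)) ν :=
    interior_subset (s := integrableExpSet id ν) hϑ
  simp_rw [famDensity_eq hν hϑ, integral_div]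
  exact div_self (mgf_pos' hν hi).ne'

theorem integrable_mul_famDensity (hν : ν ≠ 0) {ϑ : ℝ} (hϑ : ϑ ∈ natSpace ν) :
    Integrable (fun y => y * famDensity ν ϑ y) ν := by
  have hi := integrable_pow_mul_exp_of_mem_interior_integrableExpSet hϑ 1
  refine (hi.div_const (mgf id ν ϑ)).congr (Eventually.of_forall fun y => ?_)
  simp [famDensity_eq hν hϑ, mul_div_assoc]

theorem famMean_eq_deriv (hν : ν ≠ 0) {ϑ : ℝ} (hϑ : ϑ ∈ natSpace ν) :
    famMean ν ϑ = deriv (cgf id ν) ϑ := by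
  rw [deriv_cgf hϑ, famMean, ← integral_div]
  simp_rw [famDensity_eq hν hϑ, mul_div_assoc, id]

theorem hasDerivAt_cgf_famMean (hν : ν ≠ 0) {ϑ : ℝ} (hϑ : ϑ ∈ natSpace ν) :
    HasDerivAt (cgf id ν) (famMean ν ϑ) ϑ := by
  rw [famMean_eq_deriv hν hϑ]
  exact (analyticAt_cgf hϑ).differentiableAt.hasDerivAt

theorem continuousOn_famMean (hν : ν ≠ 0) : ContinuousOn (famMean ν) (natSpace ν) :=
  (analyticOnNhd_cgf.deriv.continuousOn).congr fun _ h => famMean_eq_deriv hν h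

/-- The mean of a natural exponential family is strictly increasing in the natural parameter. -/
theorem strictMonoOn_famMean (hν : ∀ c : ℝ, ν {c}ᶜ ≠ 0) :
    StrictMonoOn (famMean ν) (natSpace ν) := by
  intro s hs t ht hst
  have hν0 := ne_zero_of_nondegenerate hν
  -- `c` is the label at which the two densities cross. Hence `y - c` and the density difference
  -- have the same sign. Both densities integrate to one, so the integral of the product is the
  -- difference of the means.
  obtain ⟨c, hcm⟩ : ∃ c, c * (t - s) = cgf id ν t - cgf id ν s :=
    ⟨_, div_mul_cancel₀ _ (sub_pos.2 hst).ne'⟩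
  have hd : Integrable (fun y => famDensity ν t y - famDensity ν s y) ν :=
    (integrable_famDensity hν0 ht).sub (integrable_famDensity hν0 hs)
  have hmd : Integrable (fun y => y * famDensity ν t y - y * famDensity ν s y) ν :=
    (integrable_mul_famDensity hν0 ht).sub (integrable_mul_famDensity hν0 hs)
  have hpos : ∀ y, y ≠ c → 0 < (y - c) * (famDensity ν t y - famDensity ν s y) := by
    intro y hy
    have key : (t * y - cgf id ν t) - (s * y - cgf id ν s) = (t - s) * (y - c) := by
      linear_combination hcm
    rcases lt_or_gt_of_ne hy with h | h
    · refine mul_pos_of_neg_of_neg (sub_neg.2 h) (sub_neg.2 (Real.exp_lt_exp.2 ?_))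
      nlinarith [mul_pos (sub_pos.2 hst) (sub_pos.2 h)]
    · refine mul_pos (sub_pos.2 h) (sub_pos.2 (Real.exp_lt_exp.2 ?_))
      nlinarith [mul_pos (sub_pos.2 hst) (sub_pos.2 h)]
  have hint : Integrable (fun y => (y - c) * (famDensity ν t y - famDensity ν s y)) ν := by
    have := hmd.sub (hd.const_mul c)
    refine this.congr (Eventually.of_forall fun y => ?_)
    simp only [Pi.sub_apply]
    ring
  have hlt : 0 < ∫ y, (y - c) * (famDensity ν t y - famDensity ν s y) ∂ν := by
    rw [integral_pos_iff_support_of_nonneg _ hint]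
    · refine lt_of_lt_of_le (pos_iff_ne_zero.2 (hν c)) (measure_mono fun y hy => ?_)
      exact (hpos y hy).ne'
    · intro y
      rcases eq_or_ne y c with rfl | h
      · simp
      · exact (hpos y h).le
  have heq : ∫ y, (y - c) * (famDensity ν t y - famDensity ν s y) ∂ν
      = famMean ν t - famMean ν s := by
    have h1 : ∀ y, (y - c) * (famDensity ν t y - famDensity ν s y)
        = (y * famDensity ν t y - y * famDensity ν s y)
          - c * (famDensity ν t y - famDensity ν s y) := fun y => by ring
    simp_rw [h1]
    rw [integral_sub hmd (hd.const_mul c),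
      integral_sub (integrable_mul_famDensity hν0 ht) (integrable_mul_famDensity hν0 hs),
      integral_const_mul, integral_sub (integrable_famDensity hν0 ht)
        (integrable_famDensity hν0 hs), integral_famDensity hν0 ht, integral_famDensity hν0 hs]
    simp [famMean]
  linarith

end Family

/-! ### Bregman divergences on an interval -/

section Bregman

variable {f f' : ℝ → ℝ} {I : Set ℝ}

/-- By the mean value theorem `f s - f t = f' c * (s - t)` with `c` strictly between, and strict
monotonicity compares `f' c` with `f' t`. -/
theorem bregman_pos (hI : Convex ℝ I) (hf : ∀ t ∈ I, HasDerivAt f (f' t) t)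
    (hmono : StrictMonoOn f' I) {s t : ℝ} (hs : s ∈ I) (ht : t ∈ I) (hst : s ≠ t) :
    0 < f s - f t - f' t * (s - t) := by
  have hIcc : ∀ {a b}, a ∈ I → b ∈ I → Set.Icc a b ⊆ I := fun ha hb => hI.ordConnected.out ha hb
  rcases lt_or_gt_of_ne hst with h | h
  · obtain ⟨c, hc, hce⟩ := exists_hasDerivAt_eq_slope f f' h
      (fun x hx => (hf x (hIcc hs ht hx)).continuousAt.continuousWithinAt)
      (fun x hx => hf x (hIcc hs ht (Set.Ioo_subset_Icc_self hx)))
    have h1 := hmono (hIcc hs ht (Set.Ioo_subset_Icc_self hc)) ht hc.2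
    rw [eq_div_iff (sub_pos.2 h).ne'] at hce
    nlinarith [mul_pos (sub_pos.2 h) (sub_pos.2 h1)]
  · obtain ⟨c, hc, hce⟩ := exists_hasDerivAt_eq_slope f f' h
      (fun x hx => (hf x (hIcc ht hs hx)).continuousAt.continuousWithinAt)
      (fun x hx => hf x (hIcc ht hs (Set.Ioo_subset_Icc_self hx)))
    have h1 := hmono ht (hIcc ht hs (Set.Ioo_subset_Icc_self hc)) hc.1
    rw [eq_div_iff (sub_pos.2 h).ne'] at hce
    nlinarith [mul_pos (sub_pos.2 h) (sub_pos.2 h1)]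

theorem bregman_nonneg (hI : Convex ℝ I) (hf : ∀ t ∈ I, HasDerivAt f (f' t) t)
    (hmono : StrictMonoOn f' I) {s t : ℝ} (hs : s ∈ I) (ht : t ∈ I) :
    0 ≤ f s - f t - f' t * (s - t) := by
  rcases eq_or_ne s t with rfl | h
  · simp
  · exact (bregman_pos hI hf hmono hs ht h).le

/-- Away from the base point the Bregman divergence grows linearly, uniformly for base points in
a compact set. -/
theorem exists_bregman_growth (hIo : IsOpen I) (hI : Convex ℝ I)
    (hf : ∀ t ∈ I, HasDerivAt f (f' t) t) (hmono : StrictMonoOn f' I)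
    (hcont : ContinuousOn f' I) {T : Set ℝ} (hT : IsCompact T) (hTI : T ⊆ I)
    {ρ : ℝ} (hρ : 0 < ρ) :
    ∃ b > 0, ∀ t ∈ T, ∀ s ∈ I, ρ ≤ |s - t| → b * |s - t| ≤ f s - f t - f' t * (s - t) := by
  obtain ⟨r₀, hr₀, hsub⟩ := hT.exists_cthickening_subset_open hIo hTI
  obtain ⟨r, hr, hrr₀, hrρ⟩ : ∃ r > 0, r ≤ r₀ ∧ 2 * r ≤ ρ :=
    ⟨min r₀ (ρ / 2), by positivity, min_le_left _ _, by linarith [min_le_right r₀ (ρ / 2)]⟩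
  have hmem : ∀ t ∈ T, ∀ s, |s - t| ≤ r → s ∈ I := fun t ht s hs =>
    hsub (Metric.mem_cthickening_of_dist_le s t r₀ T ht (by rw [Real.dist_eq]; linarith))
  have hadd : ∀ t ∈ T, t + r ∈ I := fun t ht => hmem t ht _ (by simp [abs_of_pos hr])
  have hsubm : ∀ t ∈ T, t - r ∈ I := fun t ht => hmem t ht _ (by simp [abs_of_pos hr])
  -- By compactness the derivative gains a uniform positive amount over a step `r` to the right of
  -- `T`; `b₂` is the same to the left.
  obtain ⟨b₁, hb₁, h₁⟩ := hT.exists_forall_le' (f := fun t => f' (t + r) - f' t) (a := 0)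
    ((hcont.comp (by fun_prop) hadd).sub (hcont.mono hTI))
    (fun t ht => sub_pos.2 (hmono (hTI ht) (hadd t ht) (by linarith)))
  obtain ⟨b₂, hb₂, h₂⟩ := hT.exists_forall_le' (f := fun t => f' t - f' (t - r)) (a := 0)
    ((hcont.mono hTI).sub (hcont.comp (by fun_prop) hsubm))
    (fun t ht => sub_pos.2 (hmono (hsubm t ht) (hTI ht) (by linarith)))
  refine ⟨min b₁ b₂ / 2, by positivity, fun t ht s hs hst => ?_⟩
  have hm₁ := min_le_left b₁ b₂
  have hm₂ := min_le_right b₁ b₂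
  have hm : 0 < min b₁ b₂ := by positivity
  rcases le_total t s with h | h
  · rw [abs_of_nonneg (sub_nonneg.2 h)] at hst ⊢
    -- Three-point identity through `t + r`: the divergence is the sum of two nonnegative
    -- divergences and `(f' (t + r) - f' t) * (s - t - r)`. Since `2 * r ≤ ρ ≤ s - t`, the last
    -- factor is at least half of `s - t`.
    have e₁ := bregman_nonneg hI hf hmono hs (hadd t ht)
    have e₂ := bregman_nonneg hI hf hmono (hadd t ht) (hTI ht)
    have e₃ : min b₁ b₂ * (s - t - r) ≤ (f' (t + r) - f' t) * (s - t - r) :=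
      mul_le_mul_of_nonneg_right (hm₁.trans (h₁ t ht)) (by linarith)
    nlinarith [mul_nonneg hm.le (show 0 ≤ s - t - 2 * r by linarith)]
  · rw [abs_of_nonpos (sub_nonpos.2 h)] at hst ⊢
    have e₁ := bregman_nonneg hI hf hmono hs (hsubm t ht)
    have e₂ := bregman_nonneg hI hf hmono (hsubm t ht) (hTI ht)
    have e₃ : min b₁ b₂ * (t - s - r) ≤ (f' t - f' (t - r)) * (t - s - r) :=
      mul_le_mul_of_nonneg_right (hm₂.trans (h₂ t ht)) (by linarith)
    nlinarith [mul_nonneg hm.le (show 0 ≤ t - s - 2 * r by linarith)]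

end Bregman

/-! ### Inverses of continuous injections on the line -/

section Inverse

variable {f : ℝ → ℝ} {I : Set ℝ}

/-- An injective continuous function on an open set of reals is open. -/
theorem image_inter_mem_nhds (hI : IsOpen I) (hf : ContinuousOn f I) (hinj : Set.InjOn f I)
    {x : ℝ} (hx : x ∈ I) {U : Set ℝ} (hU : U ∈ 𝓝 x) : f '' (U ∩ I) ∈ 𝓝 (f x) := by
  obtain ⟨r, hr, hsub⟩ := Metric.nhds_basis_closedBall.mem_iff.1 (inter_mem hU (hI.mem_nhds hx))
  rw [Real.closedBall_eq_Icc] at hsub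
  have hc : ContinuousOn f (Set.Icc (x - r) (x + r)) :=
    hf.mono (hsub.trans Set.inter_subset_right)
  have hi : Set.InjOn f (Set.Icc (x - r) (x + r)) :=
    hinj.mono (hsub.trans Set.inter_subset_right)
  have ml : x - r ∈ Set.Icc (x - r) (x + r) := ⟨le_rfl, by linarith⟩
  have mr : x + r ∈ Set.Icc (x - r) (x + r) := ⟨by linarith, le_rfl⟩
  have mx : x ∈ Set.Icc (x - r) (x + r) := ⟨by linarith, by linarith⟩
  refine mem_of_superset ?_ (Set.image_mono hsub)
  -- On the interval `f` is strictly monotone, so `f x` lies strictly between the end values, and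
  -- all values between them are attained.
  rcases le_total (f (x - r)) (f (x + r)) with h | h
  · have hm := ContinuousOn.strictMonoOn_of_injOn_Icc (by linarith) h hc hi
    exact mem_of_superset (Icc_mem_nhds (hm ml mx (by linarith)) (hm mx mr (by linarith)))
      (intermediate_value_Icc (by linarith) hc)
  · have hm := ContinuousOn.strictAntiOn_of_injOn_Icc (by linarith) h hc hi
    exact mem_of_superset (Icc_mem_nhds (hm mx mr (by linarith)) (hm ml mx (by linarith)))
      (intermediate_value_Icc' (by linarith) hc)

theorem isOpen_image_of_injOn (hI : IsOpen I) (hf : ContinuousOn f I) (hinj : Set.InjOn f I) :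
    IsOpen (f '' I) := by
  rw [isOpen_iff_mem_nhds]
  rintro _ ⟨x, hx, rfl⟩
  simpa using image_inter_mem_nhds hI hf hinj hx univ_mem

/-- Openness of `f` is continuity of its inverse: `f '' (U ∩ I)` is a neighbourhood that the inverse
maps into `U`. -/
theorem continuousOn_invFunOn (hI : IsOpen I) (hf : ContinuousOn f I) (hinj : Set.InjOn f I) :
    ContinuousOn (Function.invFunOn f I) (f '' I) := by
  rintro _ ⟨x, hx, rfl⟩
  refine ContinuousAt.continuousWithinAt ?_
  rw [ContinuousAt, hinj.leftInvOn_invFunOn hx]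
  intro U hU
  refine mem_map.2 (mem_of_superset (image_inter_mem_nhds hI hf hinj hx hU) ?_)
  rintro _ ⟨z, ⟨hzU, hzI⟩, rfl⟩
  rwa [Set.mem_preimage, hinj.leftInvOn_invFunOn hzI]

/-- A function that is continuous at the points of a compact set is uniformly continuous there. -/
theorem IsCompact.exists_dist_lt_of_continuousAt {f : ℝ → ℝ} {K : Set ℝ} (hK : IsCompact K)
    (hf : ∀ t ∈ K, ContinuousAt f t) {ε : ℝ} (hε : 0 < ε) :
    ∃ δ > 0, ∀ t ∈ K, ∀ s, |s - t| < δ → |f s - f t| < ε := by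
  obtain ⟨δ, hδ, h⟩ := Metric.mem_uniformity_dist.1
    (hK.uniformContinuousAt_of_continuousAt f hf (Metric.dist_mem_uniformity hε))
  refine ⟨δ, hδ, fun t ht s hs => ?_⟩
  have := @h t s (by rwa [dist_comm, Real.dist_eq]) ht
  rwa [Set.mem_ofPred_eq, dist_comm, Real.dist_eq] at this

end Inverse

/-! ### Uniform visit frequencies of i.i.d. samples -/

section Frequency

variable {Ω : Type*} [MeasurableSpace Ω] {P : Measure Ω} [IsProbabilityMeasure P]
  {S : Type*} [MeasurableSpace S] {Q : Measure S} {X : ℕ → Ω → S}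

/-- With probability tending to one, an i.i.d. sequence visits a set of positive measure with
positive frequency. -/
theorem exists_frequency_visits (hX : ∀ n, Measurable (X n)) (hlaw : ∀ n, P.map (X n) = Q)
    (hindep : iIndepFun X P) {D : Set S} (hD : MeasurableSet D) (hQD : Q D ≠ 0) :
    ∃ c > 0, Tendsto (fun N : ℕ => P {ω | ¬ c * N ≤
      ∑ n ∈ Finset.range N, D.indicator (1 : S → ℝ) (X n ω)}) atTop (𝓝 0) := by
  have : IsProbabilityMeasure Q := hlaw 0 ▸ Measure.isProbabilityMeasure_map (hX 0).aemeasurable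
  have hmeas : Measurable (D.indicator (1 : S → ℝ)) := measurable_one.indicator hD
  have hq : 0 < Q.real D := ENNReal.toReal_pos hQD (measure_ne_top _ _)
  have hint : Integrable (fun ω => D.indicator (1 : S → ℝ) (X 0 ω)) P :=
    (integrable_const (1 : ℝ)).indicator (hX 0 hD)
  have hmean : ∫ ω, D.indicator (1 : S → ℝ) (X 0 ω) ∂P = Q.real D := by
    rw [← integral_map (φ := X 0) (hX 0).aemeasurable hmeas.aestronglyMeasurable, hlaw 0,
      integral_indicator_one hD]
  have hlln := strong_law_ae_real (μ := P) (fun n ω => D.indicator (1 : S → ℝ) (X n ω)) hint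
    (fun i j hij => (hindep.indepFun hij).comp hmeas hmeas)
    (fun i => (IdentDistrib.mk (hX i).aemeasurable (hX 0).aemeasurable
      ((hlaw i).trans (hlaw 0).symm)).comp hmeas)
  rw [hmean] at hlln
  have hmN : ∀ N : ℕ, Measurable fun ω =>
      (∑ n ∈ Finset.range N, D.indicator (1 : S → ℝ) (X n ω)) / N := fun N =>
    (Finset.measurable_fun_sum _ fun n _ => hmeas.comp (hX n)).div_const _
  have hm := tendstoInMeasure_of_tendsto_ae (fun N => (hmN N).aestronglyMeasurable) hlln
  rw [tendstoInMeasure_iff_dist] at hm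
  -- With half the limiting frequency as threshold, failure means a deviation of at least `Q.real D
  -- / 2`.
  refine ⟨Q.real D / 2, by positivity, tendsto_of_tendsto_of_tendsto_of_le_of_le'
    tendsto_const_nhds (hm (Q.real D / 2) (by positivity)) (by simp) ?_⟩
  filter_upwards [eventually_gt_atTop 0] with N hN
  refine measure_mono fun ω hω => ?_
  have hN' : (0 : ℝ) < N := Nat.cast_pos.2 hN
  rw [Set.mem_ofPred_eq, not_le, ← div_lt_iff₀ hN'] at hω
  rw [Set.mem_ofPred_eq, dist_comm, Real.dist_eq]
  exact le_trans (by linarith) (le_abs_self _)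

variable {E : Type*} [NormedAddCommGroup E] [NormedSpace ℝ E]
  {φ : S → E →ₗ[ℝ] ℝ} {β : S → ℝ}

/-- A vector on which the random functional does not vanish almost surely has a neighbourhood in
which the functional is bounded away from zero on a common set of positive measure. -/
theorem exists_nhds_abs_ge (hφ : ∀ v, Measurable fun x => φ x v) (hβ : Measurable β)
    (hbound : ∀ x v, |φ x v| ≤ β x * ‖v‖) {v : E} (hv : ¬ ∀ᵐ x ∂Q, φ x v = 0) :
    ∃ U ∈ 𝓝 v, ∃ r > 0, ∃ D, MeasurableSet D ∧ Q D ≠ 0 ∧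
      ∀ x ∈ D, ∀ w ∈ U, r ≤ |φ x w| := by
  -- These sets cover `φ x v ≠ 0`, so one of them is not null. On it, moving `v` by less than `1 /
  -- (k + 1) ^ 2` costs at most half of the lower bound `2 / (k + 1)`.
  set D : ℕ → Set S := fun k => {x | 2 / ((k : ℝ) + 1) ≤ |φ x v| ∧ β x ≤ k + 1} with hDdef
  have hDm : ∀ k, MeasurableSet (D k) := fun k =>
    (measurableSet_le measurable_const (hφ v).abs).inter (measurableSet_le hβ measurable_const)
  obtain ⟨k, hk⟩ : ∃ k, Q (D k) ≠ 0 := by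
    by_contra! h
    refine hv (measure_mono_null (fun x hx => ?_) (measure_iUnion_null h))
    have hx' : 0 < |φ x v| := abs_pos.2 hx
    obtain ⟨k, hk⟩ := exists_nat_gt (max (β x) (2 / |φ x v|))
    refine Set.mem_iUnion.2 ⟨k, ?_, by linarith [le_max_left (β x) (2 / |φ x v|)]⟩
    have h2 : 2 / |φ x v| < k := lt_of_le_of_lt (le_max_right _ _) hk
    rw [div_lt_iff₀ hx'] at h2
    rw [div_le_iff₀ (by positivity)]
    nlinarith
  have hk1 : (0 : ℝ) < (k : ℝ) + 1 := by positivity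
  refine ⟨Metric.ball v (1 / ((k : ℝ) + 1) ^ 2), Metric.ball_mem_nhds _ (by positivity),
    1 / ((k : ℝ) + 1), by positivity, D k, hDm k, hk, fun x hx w hw => ?_⟩
  rw [Metric.mem_ball, dist_comm, dist_eq_norm] at hw
  have h1 : |φ x v - φ x w| ≤ 1 / ((k : ℝ) + 1) := by
    rw [← map_sub]
    calc |φ x (v - w)| ≤ β x * ‖v - w‖ := hbound _ _
      _ ≤ (k + 1) * (1 / ((k : ℝ) + 1) ^ 2) :=
        mul_le_mul hx.2 hw.le (norm_nonneg _) hk1.le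
      _ = 1 / ((k : ℝ) + 1) := by field_simp
  have h2 := abs_sub_abs_le_abs_sub (φ x v) (φ x w)
  have h3 : 2 / ((k : ℝ) + 1) = 1 / ((k : ℝ) + 1) + 1 / ((k : ℝ) + 1) := by ring
  linarith [hx.1]

/-- With probability tending to one, for all unit vectors in a subspace on which the random
functional is almost surely nondegenerate, the functional is bounded away from zero with positive
frequency along the sample. -/
theorem exists_frequency_abs_ge [FiniteDimensional ℝ E] (hX : ∀ n, Measurable (X n))
    (hlaw : ∀ n, P.map (X n) = Q)
    (hindep : iIndepFun X P) (hφ : ∀ v, Measurable fun x => φ x v) (hβ : Measurable β)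
    (hbound : ∀ x v, |φ x v| ≤ β x * ‖v‖) (V : Submodule ℝ E)
    (hV : ∀ v ∈ V, (∀ᵐ x ∂Q, φ x v = 0) → v = 0) :
    ∃ r > 0, ∃ c > 0, Tendsto (fun N : ℕ => P {ω | ¬ ∀ v ∈ V, ‖v‖ = 1 → c * N ≤
      ∑ n ∈ Finset.range N, {x | r ≤ |φ x v|}.indicator (1 : S → ℝ) (X n ω)}) atTop (𝓝 0) := by
  have : ProperSpace E := FiniteDimensional.proper ℝ E
  set K : Set E := Metric.sphere 0 1 ∩ V with hK
  have hKc : IsCompact K := (isCompact_sphere _ _).inter_right V.closed_of_finiteDimensional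
  suffices h : ∃ r > 0, ∃ c > 0, Tendsto (fun N : ℕ => P {ω | ¬ ∀ v ∈ K, c * N ≤
      ∑ n ∈ Finset.range N, {x | r ≤ |φ x v|}.indicator (1 : S → ℝ) (X n ω)}) atTop (𝓝 0) by
    simpa [hK, and_imp, forall_comm (α := ‖_‖ = 1)] using h
  -- The property is local and stable under subsets and finite unions. Only monotonicity and
  -- subadditivity of `P` are used, so the events over uncountably many `v` need not be measurable.
  refine hKc.induction_on ?_ ?_ ?_ ?_
    (p := fun K => ∃ r > 0, ∃ c > 0, Tendsto (fun N : ℕ => P {ω | ¬ ∀ v ∈ K, c * N ≤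
      ∑ n ∈ Finset.range N, {x | r ≤ |φ x v|}.indicator (1 : S → ℝ) (X n ω)}) atTop (𝓝 0))
  · exact ⟨1, one_pos, 1, one_pos, by simp⟩
  · rintro s t hst ⟨r, hr, c, hc, h⟩
    refine ⟨r, hr, c, hc, tendsto_of_tendsto_of_tendsto_of_le_of_le tendsto_const_nhds h
      (fun _ => zero_le) fun N => measure_mono fun ω hω hω' => hω fun v hv => hω' v (hst hv)⟩
  · rintro s t ⟨r₁, hr₁, c₁, hc₁, h₁⟩ ⟨r₂, hr₂, c₂, hc₂, h₂⟩
    refine ⟨min r₁ r₂, lt_min hr₁ hr₂, min c₁ c₂, lt_min hc₁ hc₂,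
      tendsto_of_tendsto_of_tendsto_of_le_of_le tendsto_const_nhds
        (add_zero (0 : ENNReal) ▸ h₁.add h₂) (fun _ => zero_le) fun N => ?_⟩
    refine le_trans (measure_mono fun ω hω => ?_) (measure_union_le _ _)
    refine not_not.1 fun hcon => ?_
    rw [Set.mem_union, not_or] at hcon
    refine hω fun v hv => ?_
    have key : ∀ r c : ℝ, min r₁ r₂ ≤ r → min c₁ c₂ ≤ c → c * N ≤
        ∑ n ∈ Finset.range N, {x | r ≤ |φ x v|}.indicator (1 : S → ℝ) (X n ω) →
        min c₁ c₂ * N ≤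
        ∑ n ∈ Finset.range N, {x | min r₁ r₂ ≤ |φ x v|}.indicator (1 : S → ℝ) (X n ω) :=
      fun r c hr hc h => (mul_le_mul_of_nonneg_right hc (Nat.cast_nonneg N)).trans <|
        h.trans <| Finset.sum_le_sum fun n _ =>
          Set.indicator_le_indicator_of_subset (fun x hx => hr.trans hx) (fun _ => zero_le_one) _
    rcases hv with hv | hv
    · exact key r₁ c₁ (min_le_left _ _) (min_le_left _ _) (of_not_not hcon.1 v hv)
    · exact key r₂ c₂ (min_le_right _ _) (min_le_right _ _) (of_not_not hcon.2 v hv)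
  · intro v hv
    have hne : ¬ ∀ᵐ x ∂Q, φ x v = 0 := fun h => by
      have := hV v hv.2 h
      simp [this, hK] at hv
    obtain ⟨U, hU, r, hr, D, hD, hQD, h⟩ := exists_nhds_abs_ge hφ hβ hbound hne
    obtain ⟨c, hc, hlim⟩ := exists_frequency_visits hX hlaw hindep hD hQD
    refine ⟨U, mem_nhdsWithin_of_mem_nhds hU, r, hr, c, hc,
      tendsto_of_tendsto_of_tendsto_of_le_of_le tendsto_const_nhds hlim
      (fun _ => zero_le) fun N => measure_mono fun ω hω hω' => hω fun w hw => ?_⟩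
    exact hω'.trans <| Finset.sum_le_sum fun n _ =>
      Set.indicator_le_indicator_of_subset (fun x hx => h x hx w hw) (fun _ => zero_le_one) _

end Frequency

/-- The nonnegative multiples of differences of points of a convex set form a subspace. -/
theorem Convex.exists_submodule_smul_sub {E : Type*} [AddCommGroup E] [Module ℝ E] {s : Set E}
    (hs : Convex ℝ s) (hne : s.Nonempty) :
    ∃ V : Submodule ℝ E, ∀ v, v ∈ V ↔ ∃ r : ℝ, 0 ≤ r ∧ ∃ a ∈ s, ∃ b ∈ s, v = r • (a - b) := by
  obtain ⟨e, he⟩ := hne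
  refine ⟨{ carrier := {v | ∃ r : ℝ, 0 ≤ r ∧ ∃ a ∈ s, ∃ b ∈ s, v = r • (a - b)}
            zero_mem' := ⟨0, le_rfl, e, he, e, he, by simp⟩
            add_mem' := ?_
            smul_mem' := ?_ }, fun v => Iff.rfl⟩
  · rintro _ _ ⟨r, hr, a, ha, b, hb, rfl⟩ ⟨t, ht, c, hc, d, hd, rfl⟩
    rcases hr.eq_or_lt with rfl | hr'
    · exact ⟨t, ht, c, hc, d, hd, by simp⟩
    have hrt : 0 < r + t := by linarith
    have hsum : r / (r + t) + t / (r + t) = 1 := by rw [← add_div, div_self hrt.ne']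
    -- Averaging the endpoints with weights proportional to `r` and `t` keeps them in `s`. For
    -- negative scalars below, the two endpoints are exchanged.
    refine ⟨r + t, hrt.le, (r / (r + t)) • a + (t / (r + t)) • c,
      hs ha hc (by positivity) (by positivity) hsum, (r / (r + t)) • b + (t / (r + t)) • d,
      hs hb hd (by positivity) (by positivity) hsum, ?_⟩
    have h1 : (r + t) * (r / (r + t)) = r := mul_div_cancel₀ _ hrt.ne'
    have h2 : (r + t) * (t / (r + t)) = t := mul_div_cancel₀ _ hrt.ne'
    simp only [smul_sub, smul_add, smul_smul, h1, h2]
    abel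
  · rintro c _ ⟨r, hr, a, ha, b, hb, rfl⟩
    rcases le_total 0 c with h | h
    · exact ⟨c * r, mul_nonneg h hr, a, ha, b, hb, by rw [mul_smul]⟩
    · refine ⟨-c * r, mul_nonneg (neg_nonneg.2 h) hr, b, hb, a, ha, ?_⟩
      rw [smul_smul, ← neg_sub b a, smul_neg, neg_mul, neg_smul]

namespace GAM

variable {ι : Type*} {𝓧 : ι → Type*} [∀ k, MeasurableSpace (𝓧 k)]

/-! ### The link function and the natural parameter -/

section Link

variable (M : GAM ι 𝓧)

theorem base_ne_zero : M.base ≠ 0 := ne_zero_of_nondegenerate M.base_nondegenerate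

theorem injOn_famMean : Set.InjOn (famMean M.base) (natSpace M.base) :=
  (strictMonoOn_famMean M.base_nondegenerate).injOn

theorem isOpen_meanSpace : IsOpen (meanSpace M.base) :=
  isOpen_image_of_injOn (isOpen_natSpace _) (continuousOn_famMean M.base_ne_zero) M.injOn_famMean

theorem continuousOn_link_famMean :
    ContinuousOn (fun ϑ => M.link (famMean M.base ϑ)) (natSpace M.base) :=
  M.link_continuousOn.comp (continuousOn_famMean M.base_ne_zero) (Set.mapsTo_image _ _)

theorem injOn_link_famMean :
    Set.InjOn (fun ϑ => M.link (famMean M.base ϑ)) (natSpace M.base) :=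
  M.link_injOn.comp M.injOn_famMean (Set.mapsTo_image _ _)

theorem link_image_meanSpace : M.link '' meanSpace M.base =
    (fun ϑ => M.link (famMean M.base ϑ)) '' natSpace M.base :=
  Set.image_image _ _ _

theorem isOpen_link_image : IsOpen (M.link '' meanSpace M.base) := by
  rw [link_image_meanSpace]
  exact isOpen_image_of_injOn (isOpen_natSpace _) M.continuousOn_link_famMean
    M.injOn_link_famMean

/-- A continuous image of an interval is an interval. The parameter set inherits its convexity from
this. -/
theorem convex_link_image : Convex ℝ (M.link '' meanSpace M.base) := by
  rw [link_image_meanSpace]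
  exact ((convex_natSpace _).isPreconnected.image _ M.continuousOn_link_famMean).ordConnected.convex

theorem continuousOn_natParam :
    ContinuousOn (natParam M.base M.link) (M.link '' meanSpace M.base) := by
  rw [link_image_meanSpace]
  exact continuousOn_invFunOn (isOpen_natSpace _) M.continuousOn_link_famMean
    M.injOn_link_famMean

variable {M}

theorem natParam_mem {t : ℝ} (ht : t ∈ M.link '' meanSpace M.base) :
    natParam M.base M.link t ∈ natSpace M.base := by
  rw [link_image_meanSpace] at ht
  exact Function.invFunOn_mem ht

theorem link_famMean_natParam {t : ℝ} (ht : t ∈ M.link '' meanSpace M.base) :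
    M.link (famMean M.base (natParam M.base M.link t)) = t := by
  rw [link_image_meanSpace] at ht
  exact Function.invFunOn_eq ht

variable [Fintype ι] [DecidableEq ι]

theorem link_condMean {θ : M.Param} (hθ : θ ∈ M.paramSpace) (x : ∀ k, 𝓧 k) :
    M.link (M.condMean θ x) = M.predictor θ x :=
  link_famMean_natParam (hθ x)

end Link

/-! ### Linearity and bounds of the predictor -/

section Linear

variable [Fintype ι] [DecidableEq ι] (M : GAM ι 𝓧)

/-- The part of the additive predictor that uses only the features in `S`, as a linear functional
of the parameter. -/
noncomputable def predictorLin (S : Set ι) (x : ∀ k, 𝓧 k) : M.Param →ₗ[ℝ] ℝ where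
  toFun θ := M.predictorOn S θ x
  map_add' θ θ' := by
    simp only [predictorOn, shape, pairShape, Prod.fst_add, Prod.snd_add, Pi.add_apply, add_mul,
      Finset.sum_add_distrib, ite_add_zero]
    ring
  map_smul' c θ := by
    simp only [predictorOn, shape, pairShape, Prod.smul_fst, Prod.smul_snd, Pi.smul_apply,
      smul_eq_mul, mul_assoc, ← Finset.mul_sum, RingHom.id_apply, mul_add, ← mul_ite_zero]

theorem predictorLin_apply (S : Set ι) (x : ∀ k, 𝓧 k) (θ : M.Param) :
    M.predictorLin S x θ = M.predictorOn S θ x := rfl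

theorem predictorOn_univ (θ : M.Param) (x : ∀ k, 𝓧 k) :
    M.predictorOn Set.univ θ x = M.predictor θ x := by
  simp [predictorOn, predictor]

theorem predictorLin_univ (x : ∀ k, 𝓧 k) (θ : M.Param) :
    M.predictorLin Set.univ x θ = M.predictor θ x := M.predictorOn_univ θ x

theorem measurable_predictor (θ : M.Param) : Measurable (M.predictor θ) := by
  refine (measurable_const.add (Finset.measurable_fun_sum _ fun k _ =>
    Finset.measurable_fun_sum _ fun m _ => ?_)).add (Finset.measurable_fun_sum _ fun q _ =>
    Finset.measurable_fun_sum _ fun m _ => ?_)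
  · exact ((M.measurable_basis k m).comp (measurable_pi_apply k)).const_mul _
  · exact ((M.measurable_pairBasis q m).comp
      ((measurable_pi_apply q.1.1).prodMk (measurable_pi_apply q.1.2))).const_mul _

variable {M}

theorem abs_intercept_le (θ : M.Param) : |θ.1| ≤ ‖θ‖ := norm_fst_le θ

theorem abs_coeff_le (θ : M.Param) (k : ι) (m : Fin (M.dim k)) : |θ.2.1 k m| ≤ ‖θ‖ :=
  (norm_le_pi_norm (θ.2.1 k) m).trans <| (norm_le_pi_norm θ.2.1 k).trans <|
    (norm_fst_le θ.2).trans (norm_snd_le θ)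

theorem abs_pairCoeff_le (θ : M.Param) (q : FeaturePair ι) (m : Fin (M.pairDim q)) :
    |θ.2.2 q m| ≤ ‖θ‖ :=
  (norm_le_pi_norm (θ.2.2 q) m).trans <| (norm_le_pi_norm θ.2.2 q).trans <|
    (norm_snd_le θ.2).trans (norm_snd_le θ)

theorem abs_shape_le (θ : M.Param) (k : ι) (a : 𝓧 k) :
    |M.shape θ k a| ≤ (∑ m, |M.basis k m a|) * ‖θ‖ := by
  rw [Finset.sum_mul]
  refine (Finset.abs_sum_le_sum_abs _ _).trans (Finset.sum_le_sum fun m _ => ?_)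
  rw [abs_mul, mul_comm]
  exact mul_le_mul_of_nonneg_left (abs_coeff_le θ k m) (abs_nonneg _)

theorem abs_pairShape_le (θ : M.Param) (q : FeaturePair ι) (a : 𝓧 q.1.1) (b : 𝓧 q.1.2) :
    |M.pairShape θ q a b| ≤ (∑ m, |M.pairBasis q m a b|) * ‖θ‖ := by
  rw [Finset.sum_mul]
  refine (Finset.abs_sum_le_sum_abs _ _).trans (Finset.sum_le_sum fun m _ => ?_)
  rw [abs_mul, mul_comm]
  exact mul_le_mul_of_nonneg_left (abs_pairCoeff_le θ q m) (abs_nonneg _)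

variable (M) in
/-- A bound for the additive predictor at `x` as a linear functional of the parameter. -/
noncomputable def magnitude (x : ∀ k, 𝓧 k) : ℝ :=
  1 + ∑ k, ∑ m, |M.basis k m (x k)| +
    ∑ q : FeaturePair ι, ∑ m, |M.pairBasis q m (x q.1.1) (x q.1.2)|

variable (M) in
theorem measurable_magnitude : Measurable M.magnitude := by
  refine (measurable_const.add (Finset.measurable_fun_sum _ fun k _ =>
    Finset.measurable_fun_sum _ fun m _ => ?_)).add (Finset.measurable_fun_sum _ fun q _ =>
    Finset.measurable_fun_sum _ fun m _ => ?_)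
  · exact ((M.measurable_basis k m).comp (measurable_pi_apply k)).abs
  · exact ((M.measurable_pairBasis q m).comp
      ((measurable_pi_apply q.1.1).prodMk (measurable_pi_apply q.1.2))).abs

theorem abs_predictorOn_le (S : Set ι) (θ : M.Param) (x : ∀ k, 𝓧 k) :
    |M.predictorOn S θ x| ≤ M.magnitude x * ‖θ‖ := by
  classical
  have hite : ∀ (p : Prop) [Decidable p] (a b : ℝ), |a| ≤ b → |if p then a else 0| ≤ b := by
    intro p _ a b h
    split_ifs
    · exact h
    · simpa using (abs_nonneg a).trans h
  rw [magnitude, add_mul, add_mul, one_mul, Finset.sum_mul, Finset.sum_mul]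
  refine (abs_add_le _ _).trans (add_le_add ((abs_add_le _ _).trans
    (add_le_add (abs_intercept_le θ) ?_)) ?_)
  · exact (Finset.abs_sum_le_sum_abs _ _).trans
      (Finset.sum_le_sum fun k _ => hite _ _ _ (abs_shape_le θ k _))
  · exact (Finset.abs_sum_le_sum_abs _ _).trans
      (Finset.sum_le_sum fun q _ => hite _ _ _ (abs_pairShape_le θ q _ _))

/-- Bounded basis functions: all shapes and partial predictors are Lipschitz in the parameter,
uniformly in the features. -/
theorem BoundedBasis.exists_lipschitz (hB : M.BoundedBasis) : ∃ C > 0,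
    (∀ S (θ θ' : M.Param) x, |M.predictorOn S θ x - M.predictorOn S θ' x| ≤ C * ‖θ - θ'‖) ∧
    (∀ (θ θ' : M.Param) k a, |M.shape θ k a - M.shape θ' k a| ≤ C * ‖θ - θ'‖) ∧
    (∀ (θ θ' : M.Param) q a b, |M.pairShape θ q a b - M.pairShape θ' q a b| ≤ C * ‖θ - θ'‖) := by
  obtain ⟨B, hB₁, hB₂⟩ := hB
  have h₁ : ∀ k a, ∑ m, |M.basis k m a| ≤ M.dim k * |B| := fun k a => by
    refine (Finset.sum_le_sum fun m _ => (hB₁ k m a).trans (le_abs_self B)).trans ?_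
    simp
  have h₂ : ∀ q a b, ∑ m, |M.pairBasis q m a b| ≤ M.pairDim q * |B| := fun q a b => by
    refine (Finset.sum_le_sum fun m _ => (hB₂ q m a b).trans (le_abs_self B)).trans ?_
    simp
  have p₁ : 0 ≤ ∑ k, M.dim k * |B| := Finset.sum_nonneg fun k _ => by positivity
  have p₂ : 0 ≤ ∑ q, M.pairDim q * |B| := Finset.sum_nonneg fun q _ => by positivity
  refine ⟨1 + ∑ k, M.dim k * |B| + ∑ q, M.pairDim q * |B|, by positivity,
    fun S θ θ' x => ?_, fun θ θ' k a => ?_, fun θ θ' q a b => ?_⟩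
  · rw [← predictorLin_apply, ← predictorLin_apply, ← map_sub, predictorLin_apply]
    refine (abs_predictorOn_le S _ x).trans (mul_le_mul_of_nonneg_right ?_ (norm_nonneg _))
    exact add_le_add (add_le_add le_rfl (Finset.sum_le_sum fun k _ => h₁ k _))
      (Finset.sum_le_sum fun q _ => h₂ q _ _)
  · have : M.shape θ k a - M.shape θ' k a = M.shape (θ - θ') k a := by
      simp [shape, sub_mul, Finset.sum_sub_distrib]
    rw [this]
    refine (abs_shape_le _ k a).trans (mul_le_mul_of_nonneg_right ?_ (norm_nonneg _))
    have := Finset.single_le_sum (f := fun k => M.dim k * |B|) (fun k _ => by positivity)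
      (Finset.mem_univ k)
    linarith [h₁ k a]
  · have : M.pairShape θ q a b - M.pairShape θ' q a b = M.pairShape (θ - θ') q a b := by
      simp [pairShape, sub_mul, Finset.sum_sub_distrib]
    rw [this]
    refine (abs_pairShape_le _ q a b).trans (mul_le_mul_of_nonneg_right ?_ (norm_nonneg _))
    have := Finset.single_le_sum (f := fun q => M.pairDim q * |B|) (fun q _ => by positivity)
      (Finset.mem_univ q)
    linarith [h₂ q a b]

variable (M) in
theorem convex_paramSpace : Convex ℝ M.paramSpace := by
  intro θ hθ θ' hθ' a b ha hb hab x
  rw [← predictorLin_univ, map_add, map_smul, map_smul, predictorLin_univ, predictorLin_univ]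
  exact M.convex_link_image (hθ x) (hθ' x) ha hb hab

end Linear

/-! ### Identifiability and freezing of features -/

section Identifiability

variable [Fintype ι] [DecidableEq ι] {M : GAM ι 𝓧} {Q : Measure (∀ k, 𝓧 k)}

/-- In an identifiable model the predictor determines the parameter. -/
theorem Identifiable.eq_of_ae (hid : M.Identifiable Q) {θ θ' : M.Param} (hθ : θ ∈ M.paramSpace)
    (hθ' : θ' ∈ M.paramSpace) (h : ∀ᵐ x ∂Q, M.predictor θ x = M.predictor θ' x) : θ = θ' := by
  have := M.sigmaFinite_base
  refine hid hθ hθ' (withDensity_congr_ae ?_)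
  filter_upwards [Measure.quasiMeasurePreserving_fst.ae h] with z hz
  simp only [density, hz]

/-- The parameters without coefficients for shapes that involve the feature `j`. -/
noncomputable def noCoeff (M : GAM ι 𝓧) (j : ι) : Submodule ℝ M.Param where
  carrier := {θ | θ.2.1 j = 0 ∧ ∀ q : FeaturePair ι, (q.1.1 = j ∨ q.1.2 = j) → θ.2.2 q = 0}
  zero_mem' := ⟨rfl, fun _ _ => rfl⟩
  add_mem' h h' := ⟨by simp [h.1, h'.1], fun q hq => by simp [h.2 q hq, h'.2 q hq]⟩
  smul_mem' c _ h := ⟨by simp [h.1], fun q hq => by simp [h.2 q hq]⟩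

omit [Fintype ι] [DecidableEq ι] in
theorem nullified_of_mem_noCoeff {θ : M.Param} {j : ι} (h : θ ∈ M.noCoeff j) :
    M.Nullified θ j :=
  ⟨fun a => by simp [shape, h.1], fun q hq a b => by simp [pairShape, h.2 q hq]⟩

theorem predictor_intercept (c : ℝ) (x : ∀ k, 𝓧 k) :
    M.predictor ((c, 0, 0) : M.Param) x = c := by
  simp [predictor, shape, pairShape]

theorem predictor_single (k : ι) (β : Fin (M.dim k) → ℝ) (x : ∀ k, 𝓧 k) :
    M.predictor ((0, Pi.single k β, 0) : M.Param) x = ∑ l, β l * M.basis k l (x k) := by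
  have h : ∑ k', M.shape ((0, Pi.single k β, 0) : M.Param) k' (x k')
      = ∑ l, β l * M.basis k l (x k) := by
    rw [Finset.sum_eq_single k]
    · simp [shape]
    · intro k' _ hk'
      simp [shape, Pi.single_eq_of_ne hk']
    · simp
  rw [predictor, h]
  simp [pairShape]

theorem predictor_pairSingle (q : FeaturePair ι) (γ : Fin (M.pairDim q) → ℝ) (x : ∀ k, 𝓧 k) :
    M.predictor ((0, 0, Pi.single q γ) : M.Param) x
      = ∑ m, γ m * M.pairBasis q m (x q.1.1) (x q.1.2) := by
  have h : ∑ q', M.pairShape ((0, 0, Pi.single q γ) : M.Param) q' (x q'.1.1) (x q'.1.2)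
      = ∑ m, γ m * M.pairBasis q m (x q.1.1) (x q.1.2) := by
    rw [Finset.sum_eq_single q]
    · simp [pairShape]
    · intro q' _ hq'
      simp [pairShape, Pi.single_eq_of_ne hq']
    · simp
  rw [predictor, h]
  simp [shape]

variable (M) in
/-- The functions of the features that are predictors of parameters without coefficients
for `j`. -/
noncomputable def predictorsWithout (j : ι) : Submodule ℝ ((∀ k, 𝓧 k) → ℝ) :=
  (M.noCoeff j).map (LinearMap.pi fun x => M.predictorLin Set.univ x)

theorem mem_predictorsWithout {j : ι} {F : (∀ k, 𝓧 k) → ℝ} :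
    F ∈ M.predictorsWithout j ↔ ∃ θ ∈ M.noCoeff j, ∀ x, M.predictor θ x = F x := by
  simp only [predictorsWithout, Submodule.mem_map, funext_iff, LinearMap.pi_apply,
    predictorLin_univ]

theorem const_mem_predictorsWithout (j : ι) (c : ℝ) :
    (fun _ => c) ∈ M.predictorsWithout j :=
  mem_predictorsWithout.2 ⟨(c, 0, 0), ⟨rfl, fun _ _ => rfl⟩, predictor_intercept c⟩

theorem sum_basis_mem_predictorsWithout {j k : ι} (hk : k ≠ j) (β : Fin (M.dim k) → ℝ) :
    (fun x => ∑ l, β l * M.basis k l (x k)) ∈ M.predictorsWithout j :=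
  mem_predictorsWithout.2 ⟨(0, Pi.single k β, 0),
    ⟨Pi.single_eq_of_ne hk.symm _, fun _ _ => rfl⟩, predictor_single k β⟩

theorem sum_pairBasis_mem_predictorsWithout {j : ι} {q : FeaturePair ι}
    (hq : ¬ (q.1.1 = j ∨ q.1.2 = j)) (γ : Fin (M.pairDim q) → ℝ) :
    (fun x => ∑ m, γ m * M.pairBasis q m (x q.1.1) (x q.1.2)) ∈ M.predictorsWithout j := by
  refine mem_predictorsWithout.2 ⟨(0, 0, Pi.single q γ), ⟨rfl, fun q' hq' => ?_⟩,
    predictor_pairSingle q γ⟩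
  refine Pi.single_eq_of_ne ?_ _
  rintro rfl
  exact hq hq'

/-- In a hierarchical model, freezing feature `j` in the predictor gives the predictor of a
parameter without coefficients for `j`. -/
theorem Hierarchical.exists_freeze (hhier : M.Hierarchical) (θ : M.Param) (j : ι)
    (z : ∀ k, 𝓧 k) : ∃ θ' ∈ M.noCoeff j,
      ∀ x, M.predictor θ' x = M.predictor θ (Function.update x j (z j)) := by
  rw [← mem_predictorsWithout (F := fun x => M.predictor θ (Function.update x j (z j)))]
  have hself : ∀ (x : ∀ k, 𝓧 k) k, k = j → Function.update x j (z j) k = z k := by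
    rintro x k rfl
    simp
  have hne : ∀ (x : ∀ k, 𝓧 k) k, k ≠ j → Function.update x j (z j) k = x k :=
    fun x k hk => Function.update_of_ne hk _ _
  have hfun : (fun x => M.predictor θ (Function.update x j (z j))) =
      (fun _ => θ.1) + ∑ k, (fun x => M.shape θ k (Function.update x j (z j) k)) +
      ∑ q : FeaturePair ι, fun x => ∑ m, θ.2.2 q m * M.pairBasis q m
        (Function.update x j (z j) q.1.1) (Function.update x j (z j) q.1.2) := by
    ext x
    simp [predictor, pairShape]
  -- The target is a submodule, so each summand can be frozen separately.
  rw [hfun]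
  refine add_mem (add_mem (const_mem_predictorsWithout j _) (sum_mem fun k _ => ?_))
    (sum_mem fun q _ => ?_)
  · by_cases hk : k = j
    · simp only [hself _ k hk]
      exact const_mem_predictorsWithout j _
    · simp only [hne _ k hk]
      exact sum_basis_mem_predictorsWithout hk _
  · have hsum : ∀ F : Fin (M.pairDim q) → (∀ k, 𝓧 k) → ℝ,
        (∀ m, F m ∈ M.predictorsWithout j) →
        (fun x => ∑ m, θ.2.2 q m * F m x) ∈ M.predictorsWithout j := fun F hF => by
      have : (fun x => ∑ m, θ.2.2 q m * F m x) = ∑ m, θ.2.2 q m • F m := by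
        ext x
        simp
      rw [this]
      exact sum_mem fun m _ => Submodule.smul_mem _ _ (hF m)
    by_cases h₁ : q.1.1 = j
    · have h₂ : q.1.2 ≠ j := fun h => q.2 (h₁.trans h.symm)
      refine hsum _ fun m => ?_
      obtain ⟨c, β, hβ⟩ := (hhier q m).2 (z q.1.1)
      simp only [hself _ _ h₁, hne _ _ h₂, hβ]
      exact add_mem (const_mem_predictorsWithout j c) (sum_basis_mem_predictorsWithout h₂ β)
    · by_cases h₂ : q.1.2 = j
      · refine hsum _ fun m => ?_
        obtain ⟨c, β, hβ⟩ := (hhier q m).1 (z q.1.2)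
        simp only [hself _ _ h₂, hne _ _ h₁, hβ]
        exact add_mem (const_mem_predictorsWithout j c) (sum_basis_mem_predictorsWithout h₁ β)
      · simp only [hne _ _ h₁, hne _ _ h₂]
        exact sum_pairBasis_mem_predictorsWithout (not_or.2 ⟨h₁, h₂⟩) _

/-- If the conditional mean of an identifiable hierarchical model does not depend on a feature,
then all shapes involving this feature vanish. -/
theorem nullified_of_not_determining (hid : M.Identifiable Q) (hhier : M.Hierarchical)
    {θ : M.Param} (hθ : θ ∈ M.paramSpace) {j : ι} (hj : j ∉ determining (M.condMean θ))
    (z : ∀ k, 𝓧 k) : M.Nullified θ j := by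
  obtain ⟨θ', hθ', h⟩ := hhier.exists_freeze θ j z
  have heq : ∀ x, M.predictor θ' x = M.predictor θ x := fun x => by
    have : M.condMean θ (Function.update x j (z j)) = M.condMean θ x :=
      not_not.1 fun hne => hj ⟨x, z j, hne⟩
    rw [h, ← link_condMean hθ, this, link_condMean hθ]
  have hmem : θ' ∈ M.paramSpace := fun x => by
    rw [heq]
    exact hθ x
  rw [← hid.eq_of_ae hmem hθ (Eventually.of_forall heq)]
  exact nullified_of_mem_noCoeff hθ'

theorem predictorOn_eq_predictor {S : Set ι} {θ : M.Param} (h : ∀ j ∉ S, M.Nullified θ j)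
    (x : ∀ k, 𝓧 k) : M.predictorOn S θ x = M.predictor θ x := by
  classical
  rw [predictorOn, predictor]
  congr 1
  · congr 1
    refine Finset.sum_congr rfl fun k _ => ?_
    split_ifs with hk
    · rfl
    · exact ((h k hk).1 _).symm
  · refine Finset.sum_congr rfl fun q _ => ?_
    split_ifs with hq
    · rfl
    · rcases not_and_or.1 hq with hq | hq
      · exact ((h _ hq).2 q (Or.inl rfl) _ _).symm
      · exact ((h _ hq).2 q (Or.inr rfl) _ _).symm

/-- Used contrapositively: a feature on which the mean depends must carry a nonzero shape. -/
theorem condMean_update_of_not_nonzeroShape {θ : M.Param} {k : ι} (h : ¬ M.NonzeroShape θ k)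
    (x : ∀ k, 𝓧 k) (a : 𝓧 k) : M.condMean θ (Function.update x k a) = M.condMean θ x := by
  simp only [NonzeroShape, not_or, not_exists, not_and, not_not] at h
  have : M.predictor θ (Function.update x k a) = M.predictor θ x := by
    rw [predictor, predictor]
    congr 1
    · congr 1
      refine Finset.sum_congr rfl fun i _ => ?_
      by_cases hi : i = k
      · subst hi
        rw [h.1, h.1]
      · rw [Function.update_of_ne hi]
    · refine Finset.sum_congr rfl fun q _ => ?_
      by_cases hq : q.1.1 = k ∨ q.1.2 = k
      · rw [h.2 q hq, h.2 q hq]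
      · rw [not_or] at hq
        rw [Function.update_of_ne hq.1, Function.update_of_ne hq.2]
  rw [condMean, condMean, this]

end Identifiability

end GAM

namespace GAM

variable {ι : Type*} [Fintype ι] [DecidableEq ι] {𝓧 : ι → Type*} [∀ k, MeasurableSpace (𝓧 k)]
  {M : GAM ι 𝓧}

/-! ### Likelihood comparison with the true parameter -/

section Likelihood

/-- The logarithm of the density. -/
noncomputable def logDensity (M : GAM ι 𝓧) (θ : M.Param) (x : ∀ k, 𝓧 k) (y : ℝ) : ℝ :=
  natParam M.base M.link (M.predictor θ x) * y
    - cgf id M.base (natParam M.base M.link (M.predictor θ x))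

theorem likelihood_eq_exp (N : ℕ) (x : ℕ → ∀ k, 𝓧 k) (y : ℕ → ℝ) (θ : M.Param) :
    M.likelihood N x y θ = Real.exp (∑ n ∈ Finset.range N, M.logDensity θ (x n) (y n)) :=
  (Real.exp_sum _ _).symm

/-- The first term is the Bregman divergence of the cumulant function based at `θ₀`, the second the
effect of the label error, linear in the difference of natural parameters and zero for exact labels.
-/
theorem logDensity_sub (θ₀ θ : M.Param) (x : ∀ k, 𝓧 k) (y : ℝ) :
    M.logDensity θ₀ x y - M.logDensity θ x y =
      (cgf id M.base (natParam M.base M.link (M.predictor θ x))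
        - cgf id M.base (natParam M.base M.link (M.predictor θ₀ x))
        - famMean M.base (natParam M.base M.link (M.predictor θ₀ x))
          * (natParam M.base M.link (M.predictor θ x)
            - natParam M.base M.link (M.predictor θ₀ x)))
      - (y - M.condMean θ₀ x) * (natParam M.base M.link (M.predictor θ x)
            - natParam M.base M.link (M.predictor θ₀ x)) := by
  simp only [logDensity, condMean]
  ring

theorem logDensity_condMean_le {θ₀ θ : M.Param} (hθ₀ : θ₀ ∈ M.paramSpace)
    (hθ : θ ∈ M.paramSpace) (x : ∀ k, 𝓧 k) :
    M.logDensity θ x (M.condMean θ₀ x) ≤ M.logDensity θ₀ x (M.condMean θ₀ x) := by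
  rw [← sub_nonneg, logDensity_sub, sub_self, zero_mul, sub_zero]
  exact bregman_nonneg (convex_natSpace _)
    (fun t ht => hasDerivAt_cgf_famMean M.base_ne_zero ht)
    (strictMonoOn_famMean M.base_nondegenerate) (natParam_mem (hθ x)) (natParam_mem (hθ₀ x))

theorem logDensity_condMean_lt {θ₀ θ : M.Param} (hθ₀ : θ₀ ∈ M.paramSpace)
    (hθ : θ ∈ M.paramSpace) {x : ∀ k, 𝓧 k} (hx : M.predictor θ x ≠ M.predictor θ₀ x) :
    M.logDensity θ x (M.condMean θ₀ x) < M.logDensity θ₀ x (M.condMean θ₀ x) := by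
  rw [← sub_pos, logDensity_sub, sub_self, zero_mul, sub_zero]
  refine bregman_pos (convex_natSpace _)
    (fun t ht => hasDerivAt_cgf_famMean M.base_ne_zero ht)
    (strictMonoOn_famMean M.base_nondegenerate) (natParam_mem (hθ x)) (natParam_mem (hθ₀ x)) ?_
  intro h
  apply hx
  rw [← link_famMean_natParam (hθ x), h, link_famMean_natParam (hθ₀ x)]

/-- If the labels are the conditional means under `θ₀`, then `θ₀` is an MLE. -/
theorem isMLE_of_condMean {θ₀ : M.Param} (hθ₀ : θ₀ ∈ M.paramSpace) (N : ℕ)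
    (x : ℕ → ∀ k, 𝓧 k) : M.IsMLE N x (fun n => M.condMean θ₀ (x n)) θ₀ := by
  refine ⟨hθ₀, fun θ hθ => ?_⟩
  rw [Set.mem_ofPred_eq, likelihood_eq_exp, likelihood_eq_exp, Real.exp_le_exp]
  exact Finset.sum_le_sum fun n _ => logDensity_condMean_le hθ₀ hθ (x n)

/-- If the labels are the conditional means under `θ₀`, then every MLE has the same predictor
as `θ₀` on the sample. -/
theorem IsMLE.predictor_eq {θ₀ θ : M.Param} (hθ₀ : θ₀ ∈ M.paramSpace) {N : ℕ}
    {x : ℕ → ∀ k, 𝓧 k} (h : M.IsMLE N x (fun n => M.condMean θ₀ (x n)) θ) {n : ℕ} (hn : n < N) :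
    M.predictor θ (x n) = M.predictor θ₀ (x n) := by
  by_contra hne
  have hle := h.2 hθ₀
  rw [Set.mem_ofPred_eq, likelihood_eq_exp, likelihood_eq_exp, Real.exp_le_exp] at hle
  exact hle.not_gt <| Finset.sum_lt_sum (fun n _ => logDensity_condMean_le hθ₀ h.1 (x n))
    ⟨n, Finset.mem_range.2 hn, logDensity_condMean_lt hθ₀ h.1 hne⟩

theorem continuous_predictor (x : ∀ k, 𝓧 k) : Continuous fun θ : M.Param => M.predictor θ x := by
  simp only [← predictorLin_univ]
  exact LinearMap.continuous_of_finiteDimensional _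

theorem continuousOn_likelihood (N : ℕ) (x : ℕ → ∀ k, 𝓧 k) (y : ℕ → ℝ) :
    ContinuousOn (M.likelihood N x y) M.paramSpace := by
  have hcgf : ContinuousOn (cgf id M.base) (natSpace M.base) := fun t ht =>
    (hasDerivAt_cgf_famMean M.base_ne_zero ht).continuousAt.continuousWithinAt
  have hnat : ∀ x, ContinuousOn (fun θ => natParam M.base M.link (M.predictor θ x))
      M.paramSpace := fun x =>
    M.continuousOn_natParam.comp (continuous_predictor x).continuousOn fun θ hθ => hθ x
  refine continuousOn_finsetProd _ fun n _ => Real.continuous_exp.comp_continuousOn ?_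
  exact ((hnat (x n)).mul continuousOn_const).sub
    (hcgf.comp (hnat (x n)) fun θ hθ => natParam_mem (hθ (x n)))

/-- Quantitative version of the maximality of the likelihood at `θ₀` for labels that are close
to the conditional means under `θ₀`: the likelihood is smaller at a parameter whose predictor
differs from that of `θ₀` with a sufficient frequency. -/
theorem likelihood_lt_of_frequency {θ₀ θ : M.Param} (hθ : θ ∈ M.paramSpace)
    {b ρ κ c δ : ℝ} (hb : 0 < b) (hρ : 0 < ρ) (hδ : 0 ≤ δ) (hδb : δ ≤ b / 2)
    (hδc : δ < c * b / 2)
    (hgrowth : ∀ x, ∀ s ∈ natSpace M.base,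
      ρ ≤ |s - natParam M.base M.link (M.predictor θ₀ x)| →
      b * |s - natParam M.base M.link (M.predictor θ₀ x)| ≤
        cgf id M.base s - cgf id M.base (natParam M.base M.link (M.predictor θ₀ x))
        - famMean M.base (natParam M.base M.link (M.predictor θ₀ x))
          * (s - natParam M.base M.link (M.predictor θ₀ x)))
    (hsep : ∀ x, κ ≤ |M.predictor θ x - M.predictor θ₀ x| →
      ρ ≤ |natParam M.base M.link (M.predictor θ x) - natParam M.base M.link (M.predictor θ₀ x)|)
    (hθ₀ : θ₀ ∈ M.paramSpace) {N : ℕ} (hN : 0 < N) {x : ℕ → ∀ k, 𝓧 k} {y : ℕ → ℝ}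
    (hy : ∀ n, |y n - M.condMean θ₀ (x n)| ≤ δ)
    (hfreq : c * N ≤ ∑ n ∈ Finset.range N,
      {x | κ ≤ |M.predictor θ x - M.predictor θ₀ x|}.indicator (1 : (∀ k, 𝓧 k) → ℝ) (x n)) :
    M.likelihood N x y θ < M.likelihood N x y θ₀ := by
  rw [likelihood_eq_exp, likelihood_eq_exp, Real.exp_lt_exp, ← sub_pos, ← Finset.sum_sub_distrib]
  -- Each observation loses at most `δ * ρ`, and those with visibly different predictors gain `b * ρ
  -- / 2` on top. With frequency `c` of the latter, `δ < c * b / 2` makes the sum positive.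
  have hterm : ∀ n, b * ρ / 2 * {x | κ ≤ |M.predictor θ x - M.predictor θ₀ x|}.indicator
      (1 : (∀ k, 𝓧 k) → ℝ) (x n) - δ * ρ
      ≤ M.logDensity θ₀ (x n) (y n) - M.logDensity θ (x n) (y n) := by
    intro n
    rw [logDensity_sub]
    have hg := hgrowth (x n) _ (natParam_mem (hθ (x n)))
    have hs := hsep (x n)
    have hnn := bregman_nonneg (convex_natSpace M.base)
      (fun t ht => hasDerivAt_cgf_famMean M.base_ne_zero ht)
      (strictMonoOn_famMean M.base_nondegenerate) (natParam_mem (hθ (x n)))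
      (natParam_mem (hθ₀ (x n)))
    set u := natParam M.base M.link (M.predictor θ (x n))
    set u₀ := natParam M.base M.link (M.predictor θ₀ (x n))
    have herr : (y n - M.condMean θ₀ (x n)) * (u - u₀) ≤ δ * |u - u₀| := by
      refine (le_abs_self _).trans ?_
      rw [abs_mul]
      exact mul_le_mul_of_nonneg_right (hy n) (abs_nonneg _)
    have hδρ : 0 ≤ δ * ρ := mul_nonneg hδ hρ.le
    -- As `δ ≤ b / 2`, half of the linear growth absorbs the label error, however far `u` is from
    -- `u₀`.
    have hfar : ρ ≤ |u - u₀| → b * ρ / 2 ≤ b * |u - u₀| - δ * |u - u₀| := fun h => by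
      have h1 := mul_le_mul_of_nonneg_right hδb (abs_nonneg (u - u₀))
      have h2 := mul_le_mul_of_nonneg_left h hb.le
      linarith
    by_cases hx : κ ≤ |M.predictor θ (x n) - M.predictor θ₀ (x n)|
    · rw [Set.indicator_of_mem (by exact hx), Pi.one_apply, mul_one]
      linarith [hg (hs hx), hfar (hs hx)]
    · rw [Set.indicator_of_notMem (by exact hx), mul_zero]
      rcases le_total ρ |u - u₀| with h | h
      · have : 0 < b * ρ := mul_pos hb hρ
        linarith [hg h, hfar h]
      · linarith [mul_le_mul_of_nonneg_left h hδ]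
  refine lt_of_lt_of_le ?_ (Finset.sum_le_sum fun n _ => hterm n)
  rw [Finset.sum_sub_distrib, ← Finset.mul_sum, Finset.sum_const, Finset.card_range, nsmul_eq_mul,
    sub_pos]
  have hN' : (0 : ℝ) < N := Nat.cast_pos.2 hN
  calc (N : ℝ) * (δ * ρ) < N * (c * b / 2 * ρ) := by gcongr
    _ = b * ρ / 2 * (c * N) := by ring
    _ ≤ _ := mul_le_mul_of_nonneg_left hfreq (by positivity)

end Likelihood

/-! ### Separation of parameters by the sample -/

section Sample

variable {Ω : Type*} [MeasurableSpace Ω] {P : Measure Ω} [IsProbabilityMeasure P]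
  {Q : Measure (∀ k, 𝓧 k)} {X : ℕ → Ω → ∀ k, 𝓧 k}

/-- With probability tending to one, for every parameter the predictor differs from that of `θ₀`
on the sample with positive frequency, by an amount proportional to the distance of the
parameters. -/
theorem exists_frequency_predictor_sub_ge (hX : ∀ n, Measurable (X n))
    (hlaw : ∀ n, P.map (X n) = Q) (hindep : iIndepFun X P) (hid : M.Identifiable Q)
    {θ₀ : M.Param} (hθ₀ : θ₀ ∈ M.paramSpace) :
    ∃ r > 0, ∃ c > 0, Tendsto (fun N : ℕ => P {ω | ¬ ∀ θ ∈ M.paramSpace, ∀ s > 0,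
      s ≤ ‖θ - θ₀‖ → c * N ≤ ∑ n ∈ Finset.range N,
        {x | r * s ≤ |M.predictor θ x - M.predictor θ₀ x|}.indicator
          (1 : (∀ k, 𝓧 k) → ℝ) (X n ω)}) atTop (𝓝 0) := by
  obtain ⟨V, hV⟩ := M.convex_paramSpace.exists_submodule_smul_sub ⟨θ₀, hθ₀⟩
  have hnull : ∀ v ∈ V, (∀ᵐ x ∂Q, M.predictorLin Set.univ x v = 0) → v = 0 := by
    intro v hv hae
    obtain ⟨t, ht, a, ha, b, hb, rfl⟩ := (hV v).1 hv
    rcases ht.eq_or_lt with rfl | ht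
    · exact zero_smul _ _
    · rw [hid.eq_of_ae ha hb, sub_self, smul_zero]
      filter_upwards [hae] with x hx
      rw [map_smul, map_sub, predictorLin_univ, predictorLin_univ, smul_eq_mul] at hx
      exact sub_eq_zero.1 ((mul_eq_zero.1 hx).resolve_left ht.ne')
  obtain ⟨r, hr, c, hc, h⟩ := exists_frequency_abs_ge (P := P) (φ := M.predictorLin Set.univ)
    hX hlaw hindep (fun v => by simpa only [predictorLin_univ] using M.measurable_predictor v)
    M.measurable_magnitude (fun x v => abs_predictorOn_le _ v x) V hnull
  · refine ⟨r, hr, c, hc, tendsto_of_tendsto_of_tendsto_of_le_of_le tendsto_const_nhds h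
      (fun _ => zero_le) fun N => measure_mono fun ω hω hω' => hω fun θ hθ s hs hsθ => ?_⟩
    have hpos : 0 < ‖θ - θ₀‖ := hs.trans_le hsθ
    -- Apply the bound to the normalized difference; undoing the normalization scales the threshold
    -- `r` by `‖θ - θ₀‖ ≥ s`.
    refine (hω' (‖θ - θ₀‖⁻¹ • (θ - θ₀)) ((hV _).2 ⟨_, by positivity, θ, hθ, θ₀, hθ₀, rfl⟩)
      (by rw [norm_smul, norm_inv, norm_norm, inv_mul_cancel₀ hpos.ne'])).trans ?_
    refine Finset.sum_le_sum fun n _ =>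
      Set.indicator_le_indicator_of_subset (fun x hx => ?_) (fun _ => zero_le_one) _
    rw [Set.mem_ofPred_eq, map_smul, map_sub, predictorLin_univ, predictorLin_univ, smul_eq_mul,
      abs_mul, abs_of_pos (inv_pos.2 hpos), inv_mul_eq_div, le_div_iff₀ hpos] at hx
    exact (mul_le_mul_of_nonneg_left hsθ hr.le).trans hx

end Sample

end GAM

/-! ### Nullification and localization of the MLE -/

namespace GAM

variable {ι : Type*} [Fintype ι] [DecidableEq ι] {𝓧 : ι → Type*} [∀ k, MeasurableSpace (𝓧 k)]
  {M : GAM ι 𝓧} {Q : Measure (∀ k, 𝓧 k)}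

/-- The features of the labeling function are recovered exactly from the true parameter. -/
theorem nullification_exact (hid : M.Identifiable Q) (hhier : M.Hierarchical) {θ₀ : M.Param}
    (hθ₀ : θ₀ ∈ M.paramSpace) (z : ∀ k, 𝓧 k) :
    (∀ k ∈ determining (M.condMean θ₀), M.NonzeroShape θ₀ k) ∧
      (∀ x, M.link (M.condMean θ₀ x) = M.predictorOn (determining (M.condMean θ₀)) θ₀ x) ∧
      (∀ j ∉ determining (M.condMean θ₀), M.Nullified θ₀ j) := by
  have hnull : ∀ j ∉ determining (M.condMean θ₀), M.Nullified θ₀ j := fun j hj =>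
    nullified_of_not_determining hid hhier hθ₀ hj z
  refine ⟨?_, fun x => ?_, hnull⟩
  · rintro k ⟨x, a, hxa⟩
    by_contra h
    exact hxa (condMean_update_of_not_nonzeroShape h x a)
  · rw [link_condMean hθ₀, predictorOn_eq_predictor hnull]

omit [∀ k, MeasurableSpace (𝓧 k)] in
/-- For small perturbations of the conditional mean the determining features persist. -/
theorem eventually_determining_subset (μ : (∀ k, 𝓧 k) → ℝ) :
    ∀ᶠ δ in 𝓝[>] (0 : ℝ), ∀ p : (∀ k, 𝓧 k) → ℝ, (∀ x, |p x - μ x| ≤ δ) →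
      determining μ ⊆ determining p := by
  have h : ∀ k, ∀ᶠ δ in 𝓝[>] (0 : ℝ), ∀ p : (∀ k, 𝓧 k) → ℝ, (∀ x, |p x - μ x| ≤ δ) →
      k ∈ determining μ → k ∈ determining p := by
    intro k
    by_cases hk : k ∈ determining μ
    · obtain ⟨x, a, hxa⟩ := hk
      -- Two errors below half the gap cannot close it. One witness per feature suffices, and there
      -- are finitely many features.
      have hpos : 0 < |μ (Function.update x k a) - μ x| / 2 :=
        half_pos (abs_pos.2 (sub_ne_zero.2 hxa))
      filter_upwards [Ioo_mem_nhdsGT hpos] with δ hδ p hp _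
      refine ⟨x, a, fun heq => hδ.2.not_ge ?_⟩
      have h1 := hp (Function.update x k a)
      have h2 := hp x
      rw [heq] at h1
      have h3 := abs_sub_le (μ (Function.update x k a)) (p x) (μ x)
      rw [abs_sub_comm (μ _) (p x)] at h3
      linarith
    · exact Eventually.of_forall fun _ _ _ h => absurd h hk
  filter_upwards [eventually_all.2 h] with δ hδ p hp k hk using hδ k p hp hk

/-- A parameter close to `θ₀` nearly recovers the features of a labeling function that is close to
the conditional mean under `θ₀`. -/
theorem nullification_approx (hid : M.Identifiable Q) (hhier : M.Hierarchical) {θ₀ θ : M.Param}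
    (hθ₀ : θ₀ ∈ M.paramSpace) (z : ∀ k, 𝓧 k) {ε C δ : ℝ} {p : (∀ k, 𝓧 k) → ℝ}
    (hC₁ : ∀ S x, |M.predictorOn S θ x - M.predictorOn S θ₀ x| ≤ C * ‖θ - θ₀‖)
    (hC₂ : ∀ k a, |M.shape θ k a - M.shape θ₀ k a| ≤ C * ‖θ - θ₀‖)
    (hC₃ : ∀ q a b, |M.pairShape θ q a b - M.pairShape θ₀ q a b| ≤ C * ‖θ - θ₀‖)
    (hdist : C * ‖θ - θ₀‖ ≤ ε / 2) (hε : 0 < ε) (hδ : δ ≤ ε / 4)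
    (hp : ∀ x, |p x - M.condMean θ₀ x| ≤ δ)
    (hmean : ∀ x, |M.condMean θ x - M.condMean θ₀ x| < ε / 4)
    (hlink : ∀ x, |M.link (p x) - M.link (M.condMean θ₀ x)| < ε / 2)
    (hdet : determining (M.condMean θ₀) ⊆ determining p) :
    (∀ k, (∃ (x : ∀ k, 𝓧 k) (a : 𝓧 k), ε ≤ |p (Function.update x k a) - p x|) →
        M.NonzeroShape θ k) ∧
      (∀ x, |M.condMean θ x - p x| ≤ ε ∧
        |M.link (p x) - M.predictorOn (determining p) θ x| ≤ ε) ∧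
      (∀ j ∉ determining p, M.ShapeLE θ j ε) := by
  -- By `hdet` a feature irrelevant for `p` is irrelevant for the mean at `θ₀`, so its shapes vanish
  -- exactly at `θ₀` and are small at `θ`.
  have hnull : ∀ j ∉ determining p, M.Nullified θ₀ j := fun j hj =>
    nullified_of_not_determining hid hhier hθ₀ (fun h => hj (hdet h)) z
  have hclose : ∀ x, |M.condMean θ x - p x| < ε / 2 := fun x => by
    have h1 := abs_sub_le (M.condMean θ x) (M.condMean θ₀ x) (p x)
    rw [abs_sub_comm (M.condMean θ₀ x)] at h1
    linarith [hp x, hmean x]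
  refine ⟨?_, fun x => ⟨by linarith [hclose x], ?_⟩, fun j hj => ⟨fun a => ?_, fun q hq a b => ?_⟩⟩
  · rintro k ⟨x, a, hxa⟩
    by_contra h
    have h1 := hclose (Function.update x k a)
    have h2 := hclose x
    rw [condMean_update_of_not_nonzeroShape h x a, abs_sub_comm] at h1
    linarith [abs_sub_le (p (Function.update x k a)) (M.condMean θ x) (p x)]
  · have h1 := hlink x
    rw [link_condMean hθ₀, ← predictorOn_eq_predictor hnull] at h1
    have h2 := abs_sub_le (M.link (p x)) (M.predictorOn (determining p) θ₀ x)
      (M.predictorOn (determining p) θ x)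
    rw [abs_sub_comm (M.predictorOn (determining p) θ₀ x)] at h2
    linarith [hC₁ (determining p) x]
  · have h1 := hC₂ j a
    rw [(hnull j hj).1, sub_zero] at h1
    linarith
  · have h1 := hC₃ q a b
    rw [(hnull j hj).2 q hq, sub_zero] at h1
    linarith

/-- If the likelihood is smaller than at `θ₀` outside a ball that is contained in the parameter
set, then an MLE exists and every MLE lies in the ball. -/
theorem exists_isMLE_of_likelihood_lt {θ₀ : M.Param} {s : ℝ} (hs : 0 < s)
    (hball : Metric.closedBall θ₀ s ⊆ M.paramSpace) {N : ℕ} {x : ℕ → ∀ k, 𝓧 k} {y : ℕ → ℝ}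
    (hlt : ∀ θ ∈ M.paramSpace, s ≤ ‖θ - θ₀‖ → M.likelihood N x y θ < M.likelihood N x y θ₀) :
    (∃ θ, M.IsMLE N x y θ) ∧ ∀ θ, M.IsMLE N x y θ → ‖θ - θ₀‖ ≤ s := by
  have hmem : θ₀ ∈ Metric.closedBall θ₀ s := Metric.mem_closedBall_self hs.le
  constructor
  · obtain ⟨θ, hθ, hmax⟩ := (isCompact_closedBall θ₀ s).exists_isMaxOn ⟨θ₀, hmem⟩
      ((continuousOn_likelihood N x y).mono hball)
    refine ⟨θ, hball hθ, fun θ' hθ' => ?_⟩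
    -- Parameters outside the ball lose to its centre, so the maximum over the ball is global.
    rcases le_total s ‖θ' - θ₀‖ with h | h
    · exact (hlt θ' hθ' h).le.trans (hmax hmem)
    · exact hmax (mem_closedBall_iff_norm.2 h)
  · intro θ hθ
    by_contra! h
    exact (hlt θ hθ.1 h.le).not_ge (hθ.2 (hball hmem))

end GAM

theorem mainTheorem1 {ι : Type*} [Fintype ι] [DecidableEq ι]
    {𝓧 : ι → Type*} [∀ k, MeasurableSpace (𝓧 k)]
    {Ω : Type*} [MeasurableSpace Ω] (P : Measure Ω) [IsProbabilityMeasure P]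
    (Q : Measure (∀ k, 𝓧 k)) (X : ℕ → Ω → ∀ k, 𝓧 k)
    (hX : ∀ n, Measurable (X n)) (hlaw : ∀ n, P.map (X n) = Q) (hindep : iIndepFun X P)
    (M : GAM ι 𝓧) (hid : M.Identifiable Q) (hhier : M.Hierarchical)
    (θ₀ : M.Param) (hθ₀ : θ₀ ∈ M.paramSpace) :
    -- the labeling function belongs to the model
    (∀ p : (∀ k, 𝓧 k) → ℝ, (∀ x, p x = M.condMean θ₀ x) →
      Tendsto (fun N : ℕ => P {ω | ¬ (
          (∃ θ, M.IsMLE N (fun n => X n ω) (fun n => p (X n ω)) θ) ∧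
          ∀ θ, M.IsMLE N (fun n => X n ω) (fun n => p (X n ω)) θ →
            θ = θ₀ ∧
            (∀ k ∈ determining p, M.NonzeroShape θ k) ∧
            (∀ x, M.link (p x) = M.predictorOn (determining p) θ x) ∧
            (∀ j ∉ determining p, M.Nullified θ j))})
        atTop (𝓝 0)) ∧
    -- the labeling function is approximated by the model
    (M.BoundedBasis →
      (∃ K : Set ℝ, IsCompact K ∧ K ⊆ meanSpace M.base ∧ ∀ x, M.condMean θ₀ x ∈ K) →
      ∀ ε > 0, ∃ δ > 0, ∀ p : (∀ k, 𝓧 k) → ℝ, (∀ x, |p x - M.condMean θ₀ x| ≤ δ) →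
        Tendsto (fun N : ℕ => P {ω | ¬ (
            (∃ θ, M.IsMLE N (fun n => X n ω) (fun n => p (X n ω)) θ) ∧
            ∀ θ, M.IsMLE N (fun n => X n ω) (fun n => p (X n ω)) θ →
              dist θ θ₀ ≤ ε ∧
              (∀ k, (∃ (x : ∀ k, 𝓧 k) (a : 𝓧 k), ε ≤ |p (Function.update x k a) - p x|) →
                M.NonzeroShape θ k) ∧
              (∀ x, |M.condMean θ x - p x| ≤ ε ∧
                |M.link (p x) - M.predictorOn (determining p) θ x| ≤ ε) ∧
              (∀ j ∉ determining p, M.ShapeLE θ j ε))})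
          atTop (𝓝 0)) := by
  obtain ⟨ω₀⟩ : Nonempty Ω := P.nonempty_of_neZero
  -- A feature vector exists because `Ω` is nonempty; it supplies the values at which features are
  -- frozen.
  have z : ∀ k, 𝓧 k := X 0 ω₀
  obtain ⟨r, hr, c, hc, hfreq⟩ :=
    GAM.exists_frequency_predictor_sub_ge hX hlaw hindep hid hθ₀
  refine ⟨fun p hp => ?_, fun hB ⟨K, hK, hKM, hKθ₀⟩ ε hε => ?_⟩
  · obtain rfl : p = M.condMean θ₀ := funext hp
    refine tendsto_of_tendsto_of_tendsto_of_le_of_le' tendsto_const_nhds hfreq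
      (Eventually.of_forall fun _ => zero_le) ?_
    filter_upwards [eventually_gt_atTop 0] with N hN
    refine measure_mono fun ω hω hω' => hω ⟨⟨θ₀, GAM.isMLE_of_condMean hθ₀ _ _⟩, fun θ hθ => ?_⟩
    -- Another MLE would have the same predictor on the whole sample, hence frequency zero of
    -- differing, against the bound `c * N > 0`.
    obtain rfl : θ = θ₀ := by
      by_contra hne
      have hpos : 0 < ‖θ - θ₀‖ := norm_pos_iff.2 (sub_ne_zero.2 hne)
      have h1 := hω' θ hθ.1 _ hpos le_rfl
      rw [Finset.sum_eq_zero fun n hn => Set.indicator_of_notMem ?_ _] at h1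
      · have : 0 < c * N := mul_pos hc (Nat.cast_pos.2 hN)
        linarith
      · rw [Set.mem_ofPred_eq, hθ.predictor_eq hθ₀ (Finset.mem_range.1 hn), sub_self, abs_zero,
          not_le]
        positivity
    exact ⟨rfl, GAM.nullification_exact hid hhier hθ₀ z⟩
  · obtain ⟨C, hC, hC₁, hC₂, hC₃⟩ := hB.exists_lipschitz
    have hpred : ∀ (θ : M.Param) x, |M.predictor θ x - M.predictor θ₀ x| ≤ C * ‖θ - θ₀‖ :=
      fun θ x => by simpa only [GAM.predictorOn_univ] using hC₁ Set.univ θ θ₀ x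
    set G := M.link '' meanSpace M.base with hG
    have hGo : IsOpen G := M.isOpen_link_image
    have hL : IsCompact (M.link '' K) := hK.image_of_continuousOn (M.link_continuousOn.mono hKM)
    have hLG : M.link '' K ⊆ G := Set.image_mono hKM
    have hpL : ∀ x, M.predictor θ₀ x ∈ M.link '' K := fun x =>
      ⟨_, hKθ₀ x, GAM.link_condMean hθ₀ x⟩
    -- The compact set of base points for the Bregman growth.
    set T := natParam M.base M.link '' (M.link '' K) with hT
    have hTc : IsCompact T := hL.image_of_continuousOn (M.continuousOn_natParam.mono hLG)
    have hTI : T ⊆ natSpace M.base := by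
      rintro _ ⟨t, ht, rfl⟩
      exact GAM.natParam_mem (hLG ht)
    have hpT : ∀ x, natParam M.base M.link (M.predictor θ₀ x) ∈ T := fun x => ⟨_, hpL x, rfl⟩
    obtain ⟨ρ₁, hρ₁, hmean⟩ := hL.exists_dist_lt_of_continuousAt
      (f := fun t => famMean M.base (natParam M.base M.link t))
      (fun t ht => ((continuousOn_famMean M.base_ne_zero).comp M.continuousOn_natParam
        fun _ h => GAM.natParam_mem h).continuousAt (hGo.mem_nhds (hLG ht)))
      (show 0 < ε / 4 by positivity)
    obtain ⟨ρ₂, hρ₂, hthick⟩ := hL.exists_cthickening_subset_open hGo hLG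
    obtain ⟨δ₁, hδ₁, hlink⟩ := hK.exists_dist_lt_of_continuousAt
      (fun t ht => M.link_continuousOn.continuousAt (M.isOpen_meanSpace.mem_nhds (hKM ht)))
      (show 0 < ε / 2 by positivity)
    -- The radius for the MLE: small enough for all claims about parameters in the ball, and for the
    -- ball to stay in the parameter set.
    obtain ⟨s, hs, hsε, hsε', hsρ₁, hsρ₂⟩ :
        ∃ s > 0, s ≤ ε ∧ C * s ≤ ε / 2 ∧ C * s < ρ₁ ∧ C * s ≤ ρ₂ := by
      have h0 : Tendsto (fun s => C * s) (𝓝[>] 0) (𝓝 0) := by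
        have : Tendsto (fun s => C * s) (𝓝 0) (𝓝 (C * 0)) := tendsto_id.const_mul C
        rw [mul_zero] at this
        exact this.mono_left nhdsWithin_le_nhds
      obtain ⟨s, h⟩ := ((((h0.eventually_le_const (show 0 < ε / 2 by positivity)).and
        (Ioc_mem_nhdsGT hε)).and (h0.eventually_lt_const hρ₁)).and
        (h0.eventually_le_const hρ₂)).exists
      exact ⟨s, h.1.1.2.1, h.1.1.2.2, h.1.1.1, h.1.2, h.2⟩
    -- Read contrapositively: predictors at least `r * s` apart have natural parameters at least `ρ`
    -- apart.
    obtain ⟨ρ, hρ, hsep⟩ := hTc.exists_dist_lt_of_continuousAt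
      (f := fun ϑ => M.link (famMean M.base ϑ))
      (fun t ht => M.continuousOn_link_famMean.continuousAt
        ((isOpen_natSpace _).mem_nhds (hTI ht))) (mul_pos hr hs)
    obtain ⟨b, hb, hgrowth⟩ := exists_bregman_growth (isOpen_natSpace M.base) (convex_natSpace _)
      (fun t ht => hasDerivAt_cgf_famMean M.base_ne_zero ht)
      (strictMonoOn_famMean M.base_nondegenerate) (continuousOn_famMean M.base_ne_zero) hTc hTI hρ
    -- All constants so far depend on `θ₀`, `ε` and the law of the sample, not on `p`, so `δ` is
    -- uniform in `p`.
    obtain ⟨δ, hdet, hδ, hδε, hδ₁', hδb, hδc⟩ : ∃ δ : ℝ,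
        (∀ p : (∀ k, 𝓧 k) → ℝ, (∀ x, |p x - M.condMean θ₀ x| ≤ δ) →
          determining (M.condMean θ₀) ⊆ determining p) ∧
        0 < δ ∧ δ ≤ ε / 4 ∧ δ < δ₁ ∧ δ ≤ b / 2 ∧ δ < c * b / 2 := by
      obtain ⟨δ, h⟩ := (((((GAM.eventually_determining_subset (M.condMean θ₀)).and
        (Ioc_mem_nhdsGT (show 0 < ε / 4 by positivity))).and (Ioo_mem_nhdsGT hδ₁)).and
        (Ioc_mem_nhdsGT (half_pos hb))).and
        (Ioo_mem_nhdsGT (half_pos (mul_pos hc hb)))).exists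
      exact ⟨δ, h.1.1.1.1, h.2.1, h.1.1.1.2.2, h.1.1.2.2, h.1.2.2, h.2.2⟩
    have hball : Metric.closedBall θ₀ s ⊆ M.paramSpace := fun θ hθ x => by
      rw [mem_closedBall_iff_norm] at hθ
      refine hthick (Metric.mem_cthickening_of_dist_le _ _ _ _ (hpL x) ?_)
      rw [Real.dist_eq]
      exact (hpred θ x).trans ((mul_le_mul_of_nonneg_left hθ hC.le).trans hsρ₂)
    refine ⟨δ, hδ, fun p hp => ?_⟩
    refine tendsto_of_tendsto_of_tendsto_of_le_of_le' tendsto_const_nhds hfreq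
      (Eventually.of_forall fun _ => zero_le) ?_
    filter_upwards [eventually_gt_atTop 0] with N hN
    refine measure_mono fun ω hω hω' => hω ?_
    obtain ⟨hex, hmle⟩ := GAM.exists_isMLE_of_likelihood_lt (M := M) (N := N)
      (x := fun n => X n ω) (y := fun n => p (X n ω)) hs hball fun θ hθ hsθ =>
        GAM.likelihood_lt_of_frequency hθ hb hρ hδ.le hδb hδc
          (fun x u hu => hgrowth _ (hpT x) u hu)
          (fun x hx => by
            by_contra! h
            have h1 := hsep _ (hpT x) _ h
            simp only [GAM.link_famMean_natParam (hθ x), GAM.link_famMean_natParam (hθ₀ x)] at h1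
            exact h1.not_ge hx)
          hθ₀ hN (fun n => hp _) (hω' θ hθ s hs hsθ)
    refine ⟨hex, fun θ hθ => ?_⟩
    have hθs := hmle θ hθ
    have hCs : C * ‖θ - θ₀‖ ≤ C * s := mul_le_mul_of_nonneg_left hθs hC.le
    refine ⟨(dist_eq_norm θ θ₀).trans_le (hθs.trans hsε), ?_⟩
    exact GAM.nullification_approx hid hhier hθ₀ z (hC₁ · θ θ₀) (hC₂ θ θ₀) (hC₃ θ θ₀)
      (hCs.trans hsε') hε hδε hp
      (fun x => hmean _ (hpL x) _ (((hpred θ x).trans hCs).trans_lt hsρ₁))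
      (fun x => hlink _ (hKθ₀ x) _ ((hp x).trans_lt hδ₁')) (hdet p hp)
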